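/- **Setting.** Let $\mathbf D=\langle \mathbf D_1,\mathbf D_2\rangle$ be a semiorthogonal decomposition of a triangulated category: there are fully faithful exact functors $i_k\colon\mathbf D_k\to\mathbf D$ $(k=1,2)$, a left adjoint $\tau_1^L$ of $i_1$ and a right adjoint $\tau_2^R$ of $i_2$, with $\tau_1^L i_2=0=\tau_2^R i_1$, and every $E\in\mathbf D$ sits in a distinguished triangle $i_2\tau_2^RE\to E\to i_1\tau_1^LE\to i_2\tau_2^R E[1]$. Assume that $K_0(\mathbf D)$ is finitely generated, that $i_1$ has a right adjoint $\tau_1^R$, and that there are equivalences $e_k\colon \mathbf D_k\to\mathbf C$ with a common category $\mathbf C$ such that $e_2^{-1}e_1\tau_1^R$ is left adjoint to $i_2$. Put $\Phi=\tau_1^R\circ i_2[1]\colon\mathbf D_2\to\mathbf D_1$. Let $\sigma_k=(Z_k,\mathcal P_k)$ be Bridgeland stability conditions on $\mathbf D_k$ (central charge $Z_k\colon K_0(\mathbf D_k)\to\mathbb C$ and slicing $\mathcal P_k$, with Harder–Narasimhan filtrations) that are rational, i.e. $Z_k(K_0(\mathbf D_k))\subset\mathbb Q+\sqrt{-1}\,\mathbb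 Q$. Let $\mathcal A_k=\mathcal P_k(0,1]$ be the hearts. Call $E\in\mathcal A_k$ $\sigma_k$-torsion if $\operatorname{Im}Z_k(E)=0$, and $\sigma_k$-free if $E\in\mathcal P_k(0,1)$. Assume that $\Phi$ is t-exact for the t-structures of $\sigma_2$ and $\sigma_1$, that it maps $\sigma_2$-free objects to $\sigma_1$-free objects, and that $Z_2(X)=Z_1(\Phi X)$ for all $X\in\mathcal A_2$. Let $\mathcal A=\{E\in\mathbf D\mid \tau_1^LE\in\mathcal A_1,\ \tau_2^RE\in\mathcal A_2\}$, which is the heart of a bounded t-structure. Call $E\in\mathcal A$ torsion (resp. free) if $\tau_1^LE$ and $\tau_2^RE$ are both torsion (resp. both free); this is a torsion pair on $\mathcal A$. For $\beta\in\mathbb R$, $\omega>0$ put $$\mu_{\beta,\omega}(E)=\frac{\operatorname{Im}Z_1(\tau_1^LE)-\omega\operatorname{Re}Z_2(\tau_2^RE)+\beta\operatorname{Im}Z_2(\tau_2^RE)}{\operatorname{Im}Z_1(\tau_1^LE)+\operatorname{Im}Z_2(\tau_2^RE)} .$$ A nonzero free $E$ is $\mu_{\beta,\omega}$-semistable if $\mu_{\beta,\omega}(F)\le\mu_{\beta,\omega}(E)$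 for every nonzero subobject $F\subset E$ in $\mathcal A$; let $\mu^{+}_{\beta,\omega}(E)$ and $\mu^{-}_{\beta,\omega}(E)$ be the largest and smallest slopes of the $\mu_{\beta,\omega}$-Harder–Narasimhan factors of a nonzero free $E$. Let $\mathcal F_{\beta,\omega}$ be the class of free $E$ with $E=0$ or $\mu^+_{\beta,\omega}(E)\le0$, and $\mathcal T_{\beta,\omega}$ the class of $E\in\mathcal A$ whose free part is zero or has $\mu^-_{\beta,\omega}>0$. Let $\mathcal A_{\beta,\omega}$ be the tilted heart, consisting of the $E\in\mathbf D$ that sit in a distinguished triangle $F[1]\to E\to T\to F[2]$ with $F\in\mathcal F_{\beta,\omega}$, $T\in\mathcal T_{\beta,\omega}$, and let $$Z_{\beta,\omega}(E)=Z_1(\tau_1^LE)+(\beta-\sqrt{-1}\,\omega)Z_2(\tau_2^RE),\qquad \Sigma_{\beta,\omega}=(\mathcal A_{\beta,\omega},Z_{\beta,\omega}).$$ An object $E\in\mathbf D$ is $\Sigma_{\beta,\omega}$-semistable if some shift $E[n]$ is a nonzero object of $\mathcal A_{\beta,\omega}$ such that $\arg Z_{\beta,\omega}(F)\le\arg Z_{\beta,\omega}(E[n])$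 for all nonzero subobjects $F\subset E[n]$ in $\mathcal A_{\beta,\omega}$, where $\arg\in(-\pi,\pi]$. For $\epsilon_1\in(0,\tfrac12)$ and $\epsilon_2<0$ let $$\mathcal H^+(\epsilon_1)=\{(\beta,\omega)\in\mathbb R\times\mathbb R_{>0}\mid 0<\omega^2+(\beta+1)^2-2\epsilon_1,\ 0<\omega^2+(\beta+1-2\epsilon_1)^2+2(1-2\epsilon_1)(\epsilon_1-1)\},$$ $$\mathcal H^-(\epsilon_2)=\{(\beta,\omega)\in\mathbb R\times\mathbb R_{>0}\mid 0<2\beta+1-2\epsilon_2,\ 0<\omega^2+(\beta+1-2\epsilon_2)^2+2\epsilon_2(1-2\epsilon_2)\}.$$ **Statement.** For every $(\beta,\omega)\in\mathcal H^+(\epsilon_1)\cap\mathcal H^-(\epsilon_2)$ with $\beta,\omega\in\mathbb Q$, both suprema $$\sup\left\{\frac{|Z_{\beta,\omega}(i_2\tau_2^RE)|}{|Z_{\beta,\omega}(E)|}\ \middle|\ E\ \text{is }\Sigma_{\beta,\omega}\text{-semistable}\right\},\qquad \sup\left\{\frac{|Z_2(\tau_2^RE)|}{|Z_{\beta,\omega}(E)|}\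 \middle|\ E\ \text{is }\Sigma_{\beta,\omega}\text{-semistable}\right\}$$ are finite. -/

import Mathlib

open CategoryTheory CategoryTheory.Limits CategoryTheory.Pretriangulated
open scoped ENNReal

noncomputable section

namespace GluingStability

section SingleCategory

variable (D : Type*) [Category D] [HasZeroObject D] [Preadditive D] [HasShift D ℤ]
  [∀ n : ℤ, (shiftFunctor D n).Additive] [Pretriangulated D]

/-- The relations `[Y] - [X] - [Z]`, one for every distinguished triangle `X ⟶ Y ⟶ Z ⟶ X⟦1⟧`. -/
def K0Relations : AddSubgroup (FreeAbelianGroup D) :=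
  AddSubgroup.closure
    {r | ∃ T : Triangle D, T ∈ distTriang D ∧
      r = FreeAbelianGroup.of T.obj₂ - FreeAbelianGroup.of T.obj₁ - FreeAbelianGroup.of T.obj₃}

/-- The Grothendieck group of a triangulated category. -/
abbrev K0 : Type _ := FreeAbelianGroup D ⧸ K0Relations D

variable {D}

/-- The class `[E]` of an object in the Grothendieck group. -/
def K0.of (E : D) : K0 D := QuotientAddGroup.mk (FreeAbelianGroup.of E)

/-- The map induced on Grothendieck groups by a triangulated functor. -/
def K0.map {D' : Type*} [Category D'] [HasZeroObject D'] [Preadditive D'] [HasShift D' ℤ]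
    [∀ n : ℤ, (shiftFunctor D' n).Additive] [Pretriangulated D']
    (F : D ⥤ D') [F.CommShift ℤ] [F.IsTriangulated] : K0 D →+ K0 D' :=
  QuotientAddGroup.map (K0Relations D) (K0Relations D') (FreeAbelianGroup.map F.obj) (by
    rw [K0Relations, AddSubgroup.closure_le]
    rintro _ ⟨T, hT, rfl⟩
    refine AddSubgroup.subset_closure ⟨F.mapTriangle.obj T, F.map_distinguished T hT, ?_⟩
    simp [FreeAbelianGroup.map_of_apply])

/-- A filtration `0 = E₀ ⟶ E₁ ⟶ ⋯ ⟶ Eₙ = E` by distinguished triangles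
`Eᵢ ⟶ Eᵢ₊₁ ⟶ Aᵢ ⟶ Eᵢ⟦1⟧` with nonzero `Aᵢ ∈ P (phase i)` and strictly decreasing phases.
(The values of `obj`, `factor` and `phase` beyond the range are irrelevant.)
The filtration of the zero object is the one with `n = 0`. -/
structure HNFiltration (P : ℝ → ObjectProperty D) (E : D) where
  n : ℕ
  obj : ℕ → D
  factor : ℕ → D
  phase : ℕ → ℝ
  isZero_zero : IsZero (obj 0)
  last : obj n ≅ E
  triangle : ∀ i < n, ∃ (f : obj i ⟶ obj (i + 1)) (g : obj (i + 1) ⟶ factor i)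
    (h : factor i ⟶ (obj i)⟦(1 : ℤ)⟧), Triangle.mk f g h ∈ distTriang D
  factor_mem : ∀ i < n, P (phase i) (factor i)
  factor_ne_zero : ∀ i < n, ¬ IsZero (factor i)
  phase_anti : ∀ i j, i < j → j < n → phase j < phase i

/-- The closure of a class of objects (together with `0`) under extensions. -/
inductive extensionClosure (Q : ObjectProperty D) : ObjectProperty D
  | zero (X : D) (hX : IsZero X) : extensionClosure Q X
  | of_mem (X : D) (hX : Q X) : extensionClosure Q X
  | ext (T : Triangle D) (hT : T ∈ distTriang D) (h₁ : extensionClosure Q T.obj₁)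
      (h₃ : extensionClosure Q T.obj₃) : extensionClosure Q T.obj₂

variable (D) in
/-- A Bridgeland stability condition `(Z, P)` on a triangulated category. -/
structure StabilityCondition where
  Z : K0 D →+ ℂ
  P : ℝ → ObjectProperty D
  iso_closed : ∀ φ, (P φ).IsClosedUnderIsomorphisms
  zero_mem : ∀ φ X, IsZero X → P φ X
  charge : ∀ φ E, P φ E → ¬ IsZero E →
    ∃ m : ℝ, 0 < m ∧ Z (K0.of E) = m * Complex.exp (Real.pi * φ * Complex.I)
  shift : ∀ φ E, P φ E ↔ P (φ + 1) (E⟦(1 : ℤ)⟧)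
  hom_eq_zero : ∀ φ ψ, ψ < φ → ∀ E F, P φ E → P ψ F → ∀ f : E ⟶ F, f = 0
  exists_hn : ∀ E, Nonempty (HNFiltration P E)

namespace StabilityCondition

variable (σ : StabilityCondition D)

/-- The extension closure `P(I)` of the `P(φ)` with `φ ∈ I`. -/
def slice (I : Set ℝ) : ObjectProperty D :=
  extensionClosure (fun E => ∃ φ ∈ I, σ.P φ E)

/-- The heart `P(0, 1]`. -/
def heart : ObjectProperty D := σ.slice (Set.Ioc 0 1)

/-- `σ`-torsion objects: the objects of the heart with `Im Z = 0`. -/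
def torsion : ObjectProperty D := fun E => σ.heart E ∧ (σ.Z (K0.of E)).im = 0

/-- `σ`-free objects: the objects of `P(0, 1)`. -/
def free : ObjectProperty D := σ.slice (Set.Ioo 0 1)

/-- The central charge takes its values in `ℚ + ℚ i`. -/
def IsRational : Prop := ∀ x : K0 D, ∃ p q : ℚ, σ.Z x = p + q * Complex.I

end StabilityCondition

/-- `F` is a subobject of `E` in the heart `A` of a t-structure: there is a distinguished triangle
`F ⟶ E ⟶ G ⟶ F⟦1⟧` with `F` and `G` in `A`. (Here `E` is meant to be in `A` too; such triangles
are exactly the short exact sequences of the abelian category `A`.) -/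
def IsSubobjectIn (A : ObjectProperty D) (F E : D) : Prop :=
  A F ∧ ∃ (G : D) (f : F ⟶ E) (g : E ⟶ G) (h : G ⟶ F⟦(1 : ℤ)⟧),
    A G ∧ Triangle.mk f g h ∈ distTriang D

/-- `Z`-semistability of an object of the heart `A`, where `Z` is a central charge on `A`. -/
def IsHeartSemistable (A : ObjectProperty D) (Z : K0 D →+ ℂ) (E : D) : Prop :=
  A E ∧ ¬ IsZero E ∧ ∀ F : D, ¬ IsZero F → IsSubobjectIn A F E →
    Complex.arg (Z (K0.of F)) ≤ Complex.arg (Z (K0.of E))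

/-- Semistability of an object of `D` with respect to the pair `(A, Z)`: up to a shift, the object
is a `Z`-semistable object of the heart `A`. -/
def IsPairSemistable (A : ObjectProperty D) (Z : K0 D →+ ℂ) (E : D) : Prop :=
  ∃ n : ℤ, IsHeartSemistable A Z (E⟦n⟧)

end SingleCategory

section Semiorthogonal

variable (D D₁ D₂ : Type*)
  [Category D] [HasZeroObject D] [Preadditive D] [HasShift D ℤ]
  [∀ n : ℤ, (shiftFunctor D n).Additive] [Pretriangulated D]
  [Category D₁] [HasZeroObject D₁] [Preadditive D₁] [HasShift D₁ ℤ]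
  [∀ n : ℤ, (shiftFunctor D₁ n).Additive] [Pretriangulated D₁]
  [Category D₂] [HasZeroObject D₂] [Preadditive D₂] [HasShift D₂ ℤ]
  [∀ n : ℤ, (shiftFunctor D₂ n).Additive] [Pretriangulated D₂]

/-- A semiorthogonal decomposition `D = ⟨D₁, D₂⟩`, given by fully faithful triangulated functors
`i₁`, `i₂`, a left adjoint `τ₁L` of `i₁` and a right adjoint `τ₂R` of `i₂`, such that every `E`
sits in the triangle `i₂ τ₂R E ⟶ E ⟶ i₁ τ₁L E ⟶` given by the counit and the unit. -/
structure SOD where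
  i₁ : D₁ ⥤ D
  i₂ : D₂ ⥤ D
  τ₁L : D ⥤ D₁
  τ₂R : D ⥤ D₂
  [i₁_commShift : i₁.CommShift ℤ]
  [i₂_commShift : i₂.CommShift ℤ]
  [τ₁L_commShift : τ₁L.CommShift ℤ]
  [τ₂R_commShift : τ₂R.CommShift ℤ]
  adj₁ : τ₁L ⊣ i₁
  adj₂ : i₂ ⊣ τ₂R
  [adj₁_triangulated : adj₁.IsTriangulated]
  [adj₂_triangulated : adj₂.IsTriangulated]
  [i₁_full : i₁.Full]
  [i₁_faithful : i₁.Faithful]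
  [i₂_full : i₂.Full]
  [i₂_faithful : i₂.Faithful]
  τ₁L_i₂ : ∀ X : D₂, IsZero (τ₁L.obj (i₂.obj X))
  τ₂R_i₁ : ∀ X : D₁, IsZero (τ₂R.obj (i₁.obj X))
  triangle : ∀ E : D, ∃ δ : i₁.obj (τ₁L.obj E) ⟶ (i₂.obj (τ₂R.obj E))⟦(1 : ℤ)⟧,
    Triangle.mk (adj₂.counit.app E) (adj₁.unit.app E) δ ∈ distTriang D

attribute [instance] SOD.i₁_commShift SOD.i₂_commShift SOD.τ₁L_commShift SOD.τ₂R_commShift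
  SOD.adj₁_triangulated SOD.adj₂_triangulated SOD.i₁_full SOD.i₁_faithful SOD.i₂_full
  SOD.i₂_faithful

namespace SOD

variable {D D₁ D₂} (S : SOD D D₁ D₂)

/-- A right adjoint `τ₁R` of `i₁`. -/
structure CondOne where
  τ₁R : D ⥤ D₁
  adj : S.i₁ ⊣ τ₁R

/-- The gluing functor `Φ = τ₁R ∘ i₂ [1]`. -/
def CondOne.Φ {S : SOD D D₁ D₂} (c : S.CondOne) : D₂ ⥤ D₁ :=
  S.i₂ ⋙ c.τ₁R ⋙ shiftFunctor D₁ (1 : ℤ)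

/-- In addition to a right adjoint `τ₁R` of `i₁`, equivalences of `D₁` and `D₂` with one category
`C` under which `τ₁R` becomes a left adjoint of `i₂`. -/
structure CondTwo (C : Type*) [Category C] extends S.CondOne where
  e₁ : D₁ ≌ C
  e₂ : D₂ ≌ C
  adjL : τ₁R ⋙ e₁.functor ⋙ e₂.inverse ⊣ S.i₂

variable (σ₁ : StabilityCondition D₁) (σ₂ : StabilityCondition D₂)

/-- The gluing functor is t-exact for the t-structures `(P(0, ∞), P(-∞, 1])` of `σ₂` and `σ₁`. -/
def CondThree (c : S.CondOne) : Prop :=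
  (∀ X, σ₂.slice (Set.Ioi 0) X → σ₁.slice (Set.Ioi 0) (c.Φ.obj X)) ∧
  (∀ X, σ₂.slice (Set.Iic 1) X → σ₁.slice (Set.Iic 1) (c.Φ.obj X))

/-- In addition, the gluing functor maps `σ₂`-free objects to `σ₁`-free objects. -/
def CondFour (c : S.CondOne) : Prop :=
  S.CondThree σ₁ σ₂ c ∧ ∀ X, σ₂.free X → σ₁.free (c.Φ.obj X)

/-- In addition, `Z₂(X) = Z₁(Φ X)` for all `X` in the heart of `σ₂`. -/
def CondFive (c : S.CondOne) : Prop :=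
  S.CondFour σ₁ σ₂ c ∧
    ∀ X, σ₂.heart X → σ₂.Z (K0.of X) = σ₁.Z (K0.of (c.Φ.obj X))

/-- The glued heart `gl(A₁, A₂)`. -/
def gluedHeart : ObjectProperty D :=
  fun E => σ₁.heart (S.τ₁L.obj E) ∧ σ₂.heart (S.τ₂R.obj E)

/-- `(σ₁, σ₂)`-torsion objects of the glued heart. -/
def gluedTorsion : ObjectProperty D :=
  fun E => S.gluedHeart σ₁ σ₂ E ∧ σ₁.torsion (S.τ₁L.obj E) ∧ σ₂.torsion (S.τ₂R.obj E)

/-- `(σ₁, σ₂)`-free objects of the glued heart. -/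
def gluedFree : ObjectProperty D :=
  fun E => S.gluedHeart σ₁ σ₂ E ∧ σ₁.free (S.τ₁L.obj E) ∧ σ₂.free (S.τ₂R.obj E)

variable (β ω : ℝ)

/-- The slope `μ_{β,ω}`; its denominator is positive on nonzero `(σ₁, σ₂)`-free objects. -/
def slope (E : D) : ℝ :=
  ((σ₁.Z (K0.of (S.τ₁L.obj E))).im - ω * (σ₂.Z (K0.of (S.τ₂R.obj E))).re
      + β * (σ₂.Z (K0.of (S.τ₂R.obj E))).im)
    / ((σ₁.Z (K0.of (S.τ₁L.obj E))).im + (σ₂.Z (K0.of (S.τ₂R.obj E))).im)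

/-- The nonzero `(σ₁, σ₂)`-free objects that are `μ_{β,ω}`-semistable, of slope `s`. -/
def slopeSemistable (s : ℝ) : ObjectProperty D :=
  fun E => S.gluedFree σ₁ σ₂ E ∧ ¬ IsZero E ∧ S.slope σ₁ σ₂ β ω E = s ∧
    ∀ F : D, ¬ IsZero F → IsSubobjectIn (S.gluedHeart σ₁ σ₂) F E →
      S.slope σ₁ σ₂ β ω F ≤ S.slope σ₁ σ₂ β ω E

/-- The class `F_{β,ω}`: free objects all of whose `μ_{β,ω}`-Harder-Narasimhan slopes are `≤ 0`
(that is, `μ⁺ ≤ 0`). -/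
def tiltF : ObjectProperty D :=
  fun E => S.gluedFree σ₁ σ₂ E ∧
    ∃ H : HNFiltration (S.slopeSemistable σ₁ σ₂ β ω) E, ∀ i < H.n, H.phase i ≤ 0

/-- The class `T_{β,ω}`: objects of the glued heart that are torsion, or whose free part has all
its `μ_{β,ω}`-Harder-Narasimhan slopes `> 0` (that is, `μ⁻ > 0`). The torsion objects are those
with free part `0`. -/
def tiltT : ObjectProperty D :=
  fun E => S.gluedHeart σ₁ σ₂ E ∧
    ∃ (T Q : D) (f : T ⟶ E) (g : E ⟶ Q) (h : Q ⟶ T⟦(1 : ℤ)⟧),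
      S.gluedTorsion σ₁ σ₂ T ∧ S.gluedFree σ₁ σ₂ Q ∧ Triangle.mk f g h ∈ distTriang D ∧
      ∃ H : HNFiltration (S.slopeSemistable σ₁ σ₂ β ω) Q, ∀ i < H.n, 0 < H.phase i

/-- The tilted heart `A_{β,ω}`: extensions of objects of `T_{β,ω}` by objects of
`F_{β,ω}⟦1⟧`. -/
def tiltedHeart : ObjectProperty D :=
  fun E => ∃ (F T : D) (f : F⟦(1 : ℤ)⟧ ⟶ E) (g : E ⟶ T) (h : T ⟶ F⟦(1 : ℤ)⟧⟦(1 : ℤ)⟧),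
    S.tiltF σ₁ σ₂ β ω F ∧ S.tiltT σ₁ σ₂ β ω T ∧ Triangle.mk f g h ∈ distTriang D

/-- The central charge `Z_{β,ω}(E) = Z₁(τ₁L E) + (β - i ω) Z₂(τ₂R E)`. -/
def charge : K0 D →+ ℂ :=
  σ₁.Z.comp (K0.map S.τ₁L) +
    (AddMonoidHom.mulLeft ((β : ℂ) - Complex.I * ω)).comp (σ₂.Z.comp (K0.map S.τ₂R))

/-- Semistability with respect to `Σ_{β,ω} = (A_{β,ω}, Z_{β,ω})`. -/
def IsSemistable (E : D) : Prop :=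
  IsPairSemistable (S.tiltedHeart σ₁ σ₂ β ω) (S.charge σ₁ σ₂ β ω) E

end SOD

end Semiorthogonal

/-- The region `H⁺(ε₁)` of the upper half-plane. -/
def Hplus (ε₁ : ℝ) : Set (ℝ × ℝ) :=
  {p | 0 < p.2 ∧ 0 < p.2 ^ 2 + (p.1 + 1) ^ 2 - 2 * ε₁ ∧
    0 < p.2 ^ 2 + (p.1 + 1 - 2 * ε₁) ^ 2 + 2 * (1 - 2 * ε₁) * (ε₁ - 1)}

/-- The region `H⁻(ε₂)` of the upper half-plane. -/
def Hminus (ε₂ : ℝ) : Set (ℝ × ℝ) :=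
  {p | 0 < p.2 ∧ 0 < 2 * p.1 + 1 - 2 * ε₂ ∧
    0 < p.2 ^ 2 + (p.1 + 1 - 2 * ε₂) ^ 2 + 2 * ε₂ * (1 - 2 * ε₂)}

/-- The rational points of a subset of the plane. -/
def rationalPoints (U : Set (ℝ × ℝ)) : Set (ℝ × ℝ) :=
  {p | p ∈ U ∧ ∃ b w : ℚ, p = ((b : ℝ), (w : ℝ))}

end GluingStability

end

/-! Both suprema follow from one estimate, ‖Z₂(τ₂R E)‖ ≤ M ‖Z(E)‖ for semistable `E`, where Z =
Z_{β,ω} and `M` depends only on β and ω; indeed Z(i₂ τ₂R E) = (β - iω) Z₂(τ₂R E).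

The estimate is first proved on slope-semistable free objects G. Write Z₁(τ₁L G) = a₁ + i b₁ and
Z₂(τ₂R G) = a₂ + i b₂. If the slope is at least 1, then Im Z(G) ≥ b₁ + b₂, so Im Z(G) alone bounds
Z₂. If the slope is less than 1, two test subobjects are used. The kernel K of the gluing map τ₁L G
⟶ Φ(τ₂R G) gives a subobject i₁K, which has slope exactly 1 when nonzero; hence K = 0
(`exists_kernel`). Then the fibre of G ⟶ i₂ L G, with L the left adjoint of i₂, is a subobject whose
two central charges both equal Z₁(τ₁L G) (`exists_diagonal`). Comparing slopes gives the quadratic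
inequality b₁ a₂ ≤ a₁ b₂ (`bogomolov_inequality`), which turns into a bound of |a₂| + |b₂| linear in
Re Z and |Im Z| (`norm_le_of_mul_le_mul`).

Linear bounds add up along Harder–Narasimhan filtrations. An object of the tilted heart is built
from F⟦1⟧ (slopes ≤ 0), a part U made of torsion and slopes ≥ 1, and a quotient with slopes in (0,
1). The bound for U involves only Im Z; the other two also involve Re Z, with opposite signs because
of the shift. Semistability, tested on F⟦1⟧ and on the extension of U by F⟦1⟧, controls these real
parts by ‖Z‖ (`norm_le_of_sum`). -/

noncomputable section

namespace GluingStability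

/-! ### Distinguished triangles and classes in the Grothendieck group -/

section Triangles

variable {D : Type*} [Category D] [HasZeroObject D] [Preadditive D] [HasShift D ℤ]
  [∀ n : ℤ, (shiftFunctor D n).Additive] [Pretriangulated D]

/-- The objects `X`, `Y`, `Z` are the vertices of some distinguished triangle `X ⟶ Y ⟶ Z ⟶`. -/
def DistTri (X Y Z : D) : Prop :=
  ∃ (f : X ⟶ Y) (g : Y ⟶ Z) (h : Z ⟶ X⟦(1 : ℤ)⟧), Triangle.mk f g h ∈ distTriang D

namespace DistTri

variable {X Y Z X' Y' Z' : D}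

theorem of_mem {T : Triangle D} (hT : T ∈ distTriang D) : DistTri T.obj₁ T.obj₂ T.obj₃ :=
  ⟨T.mor₁, T.mor₂, T.mor₃, hT⟩

theorem congr (h : DistTri X Y Z) (e₁ : X ≅ X') (e₂ : Y ≅ Y') (e₃ : Z ≅ Z') :
    DistTri X' Y' Z' := by
  obtain ⟨f, g, k, hT⟩ := h
  refine ⟨e₁.inv ≫ f ≫ e₂.hom, e₂.inv ≫ g ≫ e₃.hom, e₃.inv ≫ k ≫ e₁.hom⟦(1 : ℤ)⟧', ?_⟩
  refine isomorphic_distinguished _ hT _ (Triangle.isoMk _ _ e₁.symm e₂.symm e₃.symm ?_ ?_ ?_)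
  · change (e₁.inv ≫ f ≫ e₂.hom) ≫ e₂.inv = e₁.inv ≫ f
    simp
  · change (e₂.inv ≫ g ≫ e₃.hom) ≫ e₃.inv = e₂.inv ≫ g
    simp
  · change (e₃.inv ≫ k ≫ e₁.hom⟦(1 : ℤ)⟧') ≫ e₁.inv⟦(1 : ℤ)⟧' = e₃.inv ≫ k
    simp [← Functor.map_comp]

theorem rotate (h : DistTri X Y Z) : DistTri Y Z (X⟦(1 : ℤ)⟧) := by
  obtain ⟨f, g, k, hT⟩ := h
  exact of_mem (rot_of_distTriang _ hT)

theorem invRotate (h : DistTri X Y Z) : DistTri (Z⟦(-1 : ℤ)⟧) X Y := by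
  obtain ⟨f, g, k, hT⟩ := h
  exact of_mem (inv_rot_of_distTriang _ hT)

theorem shift (h : DistTri X Y Z) (n : ℤ) : DistTri (X⟦n⟧) (Y⟦n⟧) (Z⟦n⟧) := by
  obtain ⟨f, g, k, hT⟩ := h
  exact of_mem (Triangle.shift_distinguished _ hT n)

theorem of_iso_left (e : X ≅ Y) (hZ : IsZero Z) : DistTri X Y Z :=
  (of_mem (contractible_distinguished X)).congr (Iso.refl _) e ((isZero_zero D).iso hZ)

theorem of_iso_right (hX : IsZero X) (e : Y ≅ Z) : DistTri X Y Z :=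
  (of_mem (contractible_distinguished₁ Y)).congr ((isZero_zero D).iso hX) (Iso.refl _) e

theorem isZero₂ (h : DistTri X Y Z) (hX : IsZero X) (hZ : IsZero Z) : IsZero Y := by
  obtain ⟨f, g, k, hT⟩ := h
  exact Triangle.isZero₂_of_isZero₁₃ _ hT hX hZ

theorem nonempty_iso₁₂ (h : DistTri X Y Z) (hZ : IsZero Z) : Nonempty (X ≅ Y) := by
  obtain ⟨f, g, k, hT⟩ := h
  have : IsIso f := (Triangle.isZero₃_iff_isIso₁ _ hT).1 hZ
  exact ⟨asIso f⟩

theorem nonempty_iso₂₃ (h : DistTri X Y Z) (hX : IsZero X) : Nonempty (Y ≅ Z) := by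
  obtain ⟨f, g, k, hT⟩ := h
  have : IsIso g := (Triangle.isZero₁_iff_isIso₂ _ hT).1 hX
  exact ⟨asIso g⟩

theorem nonempty_iso₃₁ (h : DistTri X Y Z) (hY : IsZero Y) : Nonempty (Z ≅ X⟦(1 : ℤ)⟧) :=
  h.rotate.nonempty_iso₂₃ hY

theorem K0_of (h : DistTri X Y Z) : K0.of Y = K0.of X + K0.of Z := by
  obtain ⟨f, g, k, hT⟩ := h
  have h := (QuotientAddGroup.eq_zero_iff _).2
    (AddSubgroup.subset_closure (k := {r | ∃ T : Triangle D, T ∈ distTriang D ∧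
      r = FreeAbelianGroup.of T.obj₂ - FreeAbelianGroup.of T.obj₁ - FreeAbelianGroup.of T.obj₃})
      ⟨_, hT, rfl⟩)
  have h' : K0.of Y - K0.of X - K0.of Z = 0 := h
  rw [sub_sub, sub_eq_zero] at h'
  exact h'

theorem map {D' : Type*} [Category D'] [HasZeroObject D'] [Preadditive D'] [HasShift D' ℤ]
    [∀ n : ℤ, (shiftFunctor D' n).Additive] [Pretriangulated D']
    (F : D ⥤ D') [F.CommShift ℤ] [F.IsTriangulated] (h : DistTri X Y Z) :
    DistTri (F.obj X) (F.obj Y) (F.obj Z) := by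
  obtain ⟨f, g, k, hT⟩ := h
  exact of_mem (F.map_distinguished _ hT)

/-- The fibre of the composite `B ⟶ C ⟶ R` is an extension of the fibres. -/
theorem exists_fiber [IsTriangulated D] {A B C P R : D} (h : DistTri A B C) (h' : DistTri P C R) :
    ∃ W, DistTri W B R ∧ DistTri A W P := by
  obtain ⟨f, g, k, hT⟩ := h
  obtain ⟨f', g', k', hT'⟩ := h'
  obtain ⟨Z, z, w, hZ⟩ := distinguished_cocone_triangle (g ≫ g')
  have hrot := rot_of_distTriang _ hT
  have hrot' := rot_of_distTriang _ hT'
  have o := Triangulated.someOctahedron (rfl : g ≫ g' = g ≫ g') hrot hrot' hZ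
  have t₁ : DistTri (A⟦(1 : ℤ)⟧) Z (P⟦(1 : ℤ)⟧) := of_mem o.mem
  have t₂ : DistTri B R Z := of_mem hZ
  refine ⟨Z⟦(-1 : ℤ)⟧, t₂.invRotate, ?_⟩
  exact (t₁.shift (-1)).congr ((shiftEquiv D (1 : ℤ)).unitIso.symm.app A) (Iso.refl _)
    ((shiftEquiv D (1 : ℤ)).unitIso.symm.app P)

/-- The cone of the composite `X ⟶ Y ⟶ Y'` is an extension of the cones. -/
theorem exists_cone [IsTriangulated D] {A : D} (h : DistTri X Y Z) (h' : DistTri Y Y' A) :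
    ∃ W, DistTri X Y' W ∧ DistTri Z W A := by
  obtain ⟨f, g, k, hT⟩ := h
  obtain ⟨f', g', k', hT'⟩ := h'
  obtain ⟨W, z, w, hW⟩ := distinguished_cocone_triangle (f ≫ f')
  have o := Triangulated.someOctahedron (rfl : f ≫ f' = f ≫ f') hT hT' hW
  exact ⟨W, of_mem hW, of_mem o.mem⟩

end DistTri

theorem K0.of_isZero {X : D} (hX : IsZero X) : K0.of X = 0 := by
  have h := (DistTri.of_iso_left (Iso.refl X) hX).K0_of
  simpa using h

theorem K0.of_iso {X Y : D} (e : X ≅ Y) : K0.of X = K0.of Y := by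
  have h := (DistTri.of_iso_left e (isZero_zero D)).K0_of
  rw [K0.of_isZero (isZero_zero D), add_zero] at h
  exact h.symm

theorem K0.of_shift_one (X : D) : K0.of (X⟦(1 : ℤ)⟧) = - K0.of X := by
  have h := (DistTri.of_iso_left (Iso.refl X) (isZero_zero D)).rotate.K0_of
  rw [K0.of_isZero (isZero_zero D)] at h
  exact (neg_eq_of_add_eq_zero_right h.symm).symm

theorem K0.map_of {D' : Type*} [Category D'] [HasZeroObject D'] [Preadditive D'] [HasShift D' ℤ]
    [∀ n : ℤ, (shiftFunctor D' n).Additive] [Pretriangulated D']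
    (F : D ⥤ D') [F.CommShift ℤ] [F.IsTriangulated] (X : D) :
    K0.map F (K0.of X) = K0.of (F.obj X) := by
  simp [K0.map, K0.of, FreeAbelianGroup.map_of_apply]

end Triangles

/-! ### Filtrations with decreasing phases, and slices -/

section Filtrations

variable {D : Type*} [Category D] [HasZeroObject D] [Preadditive D] [HasShift D ℤ]
  [∀ n : ℤ, (shiftFunctor D n).Additive] [Pretriangulated D]

/-- `E` has a filtration with factors in `P φ` for decreasing `φ ∈ I`. -/
def HasHN (P : ℝ → ObjectProperty D) (I : Set ℝ) (E : D) : Prop :=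
  ∃ H : HNFiltration P E, ∀ i < H.n, H.phase i ∈ I

namespace HNFiltration

variable {P : ℝ → ObjectProperty D} {E E' A : D}

theorem distTri (H : HNFiltration P E) {i : ℕ} (hi : i < H.n) :
    DistTri (H.obj i) (H.obj (i + 1)) (H.factor i) :=
  H.triangle i hi

/-- The filtration of the zero object. -/
def ofIsZero (P : ℝ → ObjectProperty D) (hE : IsZero E) : HNFiltration P E where
  n := 0
  obj _ := E
  factor _ := E
  phase _ := 0
  isZero_zero := hE
  last := Iso.refl _
  triangle i hi := by omega
  factor_mem i hi := by omega
  factor_ne_zero i hi := by omega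
  phase_anti i j _ hj := by omega

/-- Transport of a filtration along an isomorphism. -/
def ofIso (H : HNFiltration P E) (e : E ≅ E') : HNFiltration P E' :=
  { H with last := H.last ≪≫ e }

/-- The first `k` steps of a filtration. -/
def truncate (H : HNFiltration P E) (k : ℕ) (hk : k ≤ H.n) : HNFiltration P (H.obj k) where
  n := k
  obj := H.obj
  factor := H.factor
  phase := H.phase
  isZero_zero := H.isZero_zero
  last := Iso.refl _
  triangle i hi := H.triangle i (by omega)
  factor_mem i hi := H.factor_mem i (by omega)
  factor_ne_zero i hi := H.factor_ne_zero i (by omega)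
  phase_anti i j hij hj := H.phase_anti i j hij (by omega)

/-- Enlarging a filtration by one factor of smaller phase. -/
def snoc (H : HNFiltration P E) (h : DistTri E E' A) (s : ℝ) (hA : P s A) (hA' : ¬ IsZero A)
    (hs : ∀ i < H.n, s < H.phase i) : HNFiltration P E' where
  n := H.n + 1
  -- There is one more object than there are factors: index `H.n` keeps the old last object but
  -- already carries the new factor.
  obj i := if i ≤ H.n then H.obj i else E'
  factor i := if i < H.n then H.factor i else A
  phase i := if i < H.n then H.phase i else s
  isZero_zero := by simpa using H.isZero_zero
  last := eqToIso (by simp)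
  triangle i hi := by
    change DistTri _ _ _
    rcases Nat.lt_succ_iff_lt_or_eq.1 hi with hi' | rfl
    · rw [if_pos hi', if_pos hi'.le, if_pos (Nat.succ_le_of_lt hi')]
      exact H.triangle i hi'
    · rw [if_pos le_rfl, if_neg (lt_irrefl _), if_neg (Nat.not_succ_le_self _)]
      exact h.congr H.last.symm (Iso.refl _) (Iso.refl _)
  factor_mem i hi := by
    rcases Nat.lt_succ_iff_lt_or_eq.1 hi with hi' | rfl
    · simpa [hi'] using H.factor_mem i hi'
    · simpa using hA
  factor_ne_zero i hi := by
    rcases Nat.lt_succ_iff_lt_or_eq.1 hi with hi' | rfl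
    · simpa [hi'] using H.factor_ne_zero i hi'
    · simpa using hA'
  phase_anti i j hij hj := by
    rcases Nat.lt_succ_iff_lt_or_eq.1 hj with hj' | rfl
    · rw [if_pos hj', if_pos (hij.trans hj')]
      exact H.phase_anti i j hij hj'
    · simpa [hij] using hs i hij

end HNFiltration

namespace HasHN

variable {P : ℝ → ObjectProperty D} {I J : Set ℝ} {E E' : D}

theorem of_isZero (hE : IsZero E) : HasHN P I E :=
  ⟨HNFiltration.ofIsZero P hE, fun i hi => absurd hi (Nat.not_lt_zero i)⟩

theorem of_iso (h : HasHN P I E) (e : E ≅ E') : HasHN P I E' := by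
  obtain ⟨H, hH⟩ := h
  exact ⟨H.ofIso e, hH⟩

theorem mono (h : HasHN P I E) (hIJ : I ⊆ J) : HasHN P J E := by
  obtain ⟨H, hH⟩ := h
  exact ⟨H, fun i hi => hIJ (hH i hi)⟩

/-- Induction along the steps of a filtration. -/
theorem induction (h : HasHN P I E) (Q : D → Prop) (zero : ∀ X, IsZero X → Q X)
    (step : ∀ X Y Z, DistTri X Y Z → Q X → (∃ φ ∈ I, P φ Z) → ¬ IsZero Z → Q Y) : Q E := by
  obtain ⟨H, hH⟩ := h
  have key : ∀ k ≤ H.n, Q (H.obj k) := by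
    intro k
    induction k with
    | zero => exact fun _ => zero _ H.isZero_zero
    | succ k ih =>
      exact fun hk => step _ _ _ (H.distTri hk) (ih (by omega))
        ⟨_, hH k hk, H.factor_mem k hk⟩ (H.factor_ne_zero k hk)
  -- `Q` is not assumed invariant under isomorphism, so the last step is redone with `E` in place of
  -- `H.obj H.n`.
  rcases Nat.eq_zero_or_pos H.n with hn | hn
  · have h0 := H.isZero_zero
    rw [← hn] at h0
    exact zero _ (H.last.symm.isZero_iff.2 h0)
  · obtain ⟨k, hk⟩ := Nat.exists_eq_succ_of_ne_zero hn.ne'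
    have hk' : k < H.n := by omega
    have e : H.obj (k + 1) ≅ E := eqToIso (by rw [hk]) ≪≫ H.last
    exact step _ _ _ ((H.distTri hk').congr (Iso.refl _) e (Iso.refl _)) (key k hk'.le)
      ⟨_, hH k hk', H.factor_mem k hk'⟩ (H.factor_ne_zero k hk')

/-- A filtration splits at any threshold of the phases. -/
theorem split [IsTriangulated D] (h : HasHN P I E) {L : Set ℝ} (hL : IsLowerSet L) :
    ∃ E' E'' : D, DistTri E' E E'' ∧ HasHN P (I \ L) E' ∧ HasHN P (I ∩ L) E'' := by
  classical
  obtain ⟨H, hH⟩ := h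
  -- The cut is at the first phase in `L`; phases decrease and `L` is a lower set, so all later ones
  -- are in `L` too.
  have hex : ∃ k, k = H.n ∨ (k < H.n ∧ H.phase k ∈ L) := ⟨H.n, Or.inl rfl⟩
  set k := Nat.find hex with hk
  have hkn : k ≤ H.n := Nat.find_min' hex (Or.inl rfl)
  have hlow : ∀ i < k, H.phase i ∉ L := fun i hi hiL =>
    Nat.find_min hex hi (Or.inr ⟨by omega, hiL⟩)
  have hhigh : ∀ i < H.n, k ≤ i → H.phase i ∈ L := by
    intro i hi hki
    rcases Nat.find_spec hex with h | ⟨h, hL'⟩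
    · omega
    · rcases hki.eq_or_lt with h' | h'
      · rw [← h']
        exact hL'
      · exact hL (H.phase_anti _ _ h' hi).le hL'
  -- The filtration of the quotient is grown one factor at a time, by the octahedral axiom applied
  -- to `obj k ⟶ obj (k + d) ⟶ obj (k + d + 1)`.
  have key : ∀ d, k + d ≤ H.n → ∃ E'', DistTri (H.obj k) (H.obj (k + d)) E'' ∧
      ∃ H'' : HNFiltration P E'', ∀ i < H''.n, ∃ j, k ≤ j ∧ j < k + d ∧
        H''.phase i = H.phase j := by
    intro d
    induction d with
    | zero =>
      exact fun _ => ⟨_, DistTri.of_iso_left (Iso.refl _) (isZero_zero D),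
        HNFiltration.ofIsZero P (isZero_zero D), fun i hi => absurd hi (Nat.not_lt_zero i)⟩
    | succ d ih =>
      intro hd
      obtain ⟨E'', ht, H'', hH''⟩ := ih (by omega)
      have hkd : k + d < H.n := by omega
      obtain ⟨W, hW₁, hW₂⟩ := ht.exists_cone (H.distTri hkd)
      refine ⟨W, hW₁, H''.snoc hW₂ (H.phase (k + d)) (H.factor_mem _ hkd)
        (H.factor_ne_zero _ hkd) ?_, ?_⟩
      · intro i hi
        obtain ⟨j, -, hj, hij⟩ := hH'' i hi
        rw [hij]
        exact H.phase_anti _ _ hj hkd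
      · intro i hi
        rcases Nat.lt_succ_iff_lt_or_eq.1 hi with hi' | rfl
        · obtain ⟨j, hj₁, hj₂, hij⟩ := hH'' i hi'
          exact ⟨j, hj₁, by omega, by simpa [HNFiltration.snoc, hi'] using hij⟩
        · exact ⟨k + d, by omega, by omega, by simp [HNFiltration.snoc]⟩
  obtain ⟨E'', ht, H'', hH''⟩ := key (H.n - k) (by omega)
  refine ⟨H.obj k, E'', ht.congr (Iso.refl _) (eqToIso (by congr 1; omega) ≪≫ H.last)
    (Iso.refl _), ⟨H.truncate k hkn, fun i hi => ⟨hH i (lt_of_lt_of_le hi hkn), hlow i hi⟩⟩,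
    H'', fun i hi => ?_⟩
  obtain ⟨j, hj₁, hj₂, hij⟩ := hH'' i hi
  rw [hij]
  exact ⟨hH j (by omega), hhigh j (by omega) hj₁⟩

end HasHN

theorem extensionClosure.of_distTri {Q : ObjectProperty D} {X Y Z : D} (h : DistTri X Y Z)
    (hX : extensionClosure Q X) (hZ : extensionClosure Q Z) : extensionClosure Q Y := by
  obtain ⟨f, g, k, hT⟩ := h
  exact extensionClosure.ext _ hT hX hZ

/-! ### Slices of a stability condition: shifts, orthogonality, truncation -/

namespace StabilityCondition

variable (σ : StabilityCondition D) {I J : Set ℝ} {X Y Z : D}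

theorem slice_of_isZero (hX : IsZero X) : σ.slice I X := extensionClosure.zero X hX

theorem slice_of_mem {φ : ℝ} (hφ : φ ∈ I) (hX : σ.P φ X) : σ.slice I X :=
  extensionClosure.of_mem X ⟨φ, hφ, hX⟩

variable {σ}

theorem slice_ext (h : DistTri X Y Z) (hX : σ.slice I X) (hZ : σ.slice I Z) : σ.slice I Y :=
  extensionClosure.of_distTri h hX hZ

theorem slice_of_iso (e : X ≅ Y) (hX : σ.slice I X) : σ.slice I Y :=
  slice_ext (DistTri.of_iso_left e (isZero_zero D)) hX (σ.slice_of_isZero (isZero_zero D))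

/-- Induction on objects of a slice. -/
theorem slice_induction (Q : D → Prop) (zero : ∀ X, IsZero X → Q X)
    (mem : ∀ X, ∀ φ ∈ I, σ.P φ X → Q X)
    (ext : ∀ X Y Z, DistTri X Y Z → Q X → Q Z → Q Y) (hX : σ.slice I X) : Q X := by
  induction hX with
  | zero X hX => exact zero X hX
  | of_mem X hX => exact hX.elim fun φ h => mem X φ h.1 h.2
  | ext T hT _ _ h₁ h₃ => exact ext _ _ _ (DistTri.of_mem hT) h₁ h₃

theorem slice_mono (hIJ : I ⊆ J) (hX : σ.slice I X) : σ.slice J X :=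
  slice_induction _ (fun _ => σ.slice_of_isZero)
    (fun _ _ hφ h => σ.slice_of_mem (hIJ hφ) h) (fun _ _ _ h => slice_ext h) hX

theorem slice_of_hasHN (h : HasHN σ.P I X) : σ.slice I X :=
  h.induction _ (fun _ => σ.slice_of_isZero)
    (fun _ _ _ h hX hZ _ => slice_ext h hX (hZ.elim fun _ hφ => σ.slice_of_mem hφ.1 hφ.2))

theorem slice_shift_one (hIJ : ∀ φ ∈ I, φ + 1 ∈ J) (hX : σ.slice I X) :
    σ.slice J (X⟦(1 : ℤ)⟧) :=
  slice_induction (fun X => σ.slice J (X⟦(1 : ℤ)⟧))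
    (fun _ hX => σ.slice_of_isZero ((shiftFunctor D (1 : ℤ)).map_isZero hX))
    (fun _ φ hφ h => σ.slice_of_mem (hIJ φ hφ) ((σ.shift _ _).1 h))
    (fun _ _ _ h => slice_ext (h.shift 1)) hX

theorem slice_shift_neg_one (hIJ : ∀ φ ∈ I, φ - 1 ∈ J) (hX : σ.slice I X) :
    σ.slice J (X⟦(-1 : ℤ)⟧) :=
  slice_induction (fun X => σ.slice J (X⟦(-1 : ℤ)⟧))
    (fun _ hX => σ.slice_of_isZero ((shiftFunctor D (-1 : ℤ)).map_isZero hX))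
    (fun X φ hφ h => σ.slice_of_mem (hIJ φ hφ) ((σ.shift _ _).2 (by
      have := σ.iso_closed φ
      rw [sub_add_cancel]
      exact (σ.P φ).prop_of_iso ((shiftEquiv D (1 : ℤ)).counitIso.symm.app X) h)))
    (fun _ _ _ h => slice_ext (h.shift (-1))) hX

theorem slice_of_shift_one (hIJ : ∀ φ ∈ I, φ - 1 ∈ J) (hX : σ.slice I (X⟦(1 : ℤ)⟧)) :
    σ.slice J X :=
  slice_of_iso ((shiftEquiv D (1 : ℤ)).unitIso.symm.app X) (slice_shift_neg_one hIJ hX)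

theorem slice_hom_eq_zero (hIJ : ∀ φ ∈ I, ∀ ψ ∈ J, ψ < φ) (hX : σ.slice I X)
    (hY : σ.slice J Y) (f : X ⟶ Y) : f = 0 := by
  refine slice_induction (fun X => ∀ f : X ⟶ Y, f = 0) (fun _ h f => h.eq_of_src _ _) ?_ ?_ hX f
  · intro X φ hφ hX
    refine slice_induction (fun Y => ∀ f : X ⟶ Y, f = 0) (fun _ h f => h.eq_of_tgt _ _) ?_ ?_ hY
    · exact fun Y ψ hψ hY f => σ.hom_eq_zero φ ψ (hIJ φ hφ ψ hψ) X Y hX hY f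
    · rintro A B C ⟨a, b, c, hT⟩ hA hC f
      obtain ⟨g, hg⟩ := Triangle.coyoneda_exact₂ _ hT f (hC _)
      rw [hg, hA g]
      exact zero_comp
  · rintro A B C ⟨a, b, c, hT⟩ hA hC f
    obtain ⟨g, hg⟩ := Triangle.yoneda_exact₂ _ hT f (hA _)
    rw [hg, hC g]
    exact comp_zero

theorem isZero_of_slice (hIJ : ∀ φ ∈ I, ∀ ψ ∈ J, ψ < φ) (hX : σ.slice I X)
    (hX' : σ.slice J X) : IsZero X :=
  (IsZero.iff_id_eq_zero X).2 (slice_hom_eq_zero hIJ hX hX' _)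

theorem hasHN (σ : StabilityCondition D) (X : D) : HasHN σ.P Set.univ X :=
  (σ.exists_hn X).elim fun H => ⟨H, fun _ _ => Set.mem_univ _⟩

variable [IsTriangulated D]

theorem exists_truncation (σ : StabilityCondition D) (X : D) {L : Set ℝ} (hL : IsLowerSet L) :
    ∃ X' X'', DistTri X' X X'' ∧ σ.slice Lᶜ X' ∧ σ.slice L X'' := by
  obtain ⟨X', X'', h, h', h''⟩ := (σ.hasHN X).split hL
  exact ⟨X', X'', h, slice_of_hasHN (h'.mono fun _ hx => hx.2),
    slice_of_hasHN (h''.mono Set.inter_subset_right)⟩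

/-- Split at `L`. The part with phases outside `L` is an extension of `X` by a negative shift of the
other part, so it also lies in the slice of `L`; having no endomorphisms, it vanishes. -/
theorem hasHN_inter (h : HasHN σ.P I X) {L : Set ℝ} (hL : IsLowerSet L)
    (hX : σ.slice L X) : HasHN σ.P (I ∩ L) X := by
  obtain ⟨X', X'', t, h', h''⟩ := h.split hL
  have hX' : σ.slice L X' := slice_ext t.invRotate
    (slice_shift_neg_one (fun φ hφ => hL (by linarith) hφ.2) (slice_of_hasHN h'')) hX
  have h0 : IsZero X' := isZero_of_slice (I := I \ L) (fun φ hφ ψ hψ => by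
    by_contra! hle
    exact hφ.2 (hL hle hψ)) (slice_of_hasHN h') hX'
  obtain ⟨e⟩ := t.nonempty_iso₂₃ h0
  exact h''.of_iso e.symm

theorem hasHN_diff (h : HasHN σ.P I X) {L : Set ℝ} (hL : IsLowerSet L)
    (hX : σ.slice Lᶜ X) : HasHN σ.P (I \ L) X := by
  obtain ⟨X', X'', t, h', h''⟩ := h.split hL
  have hX'' : σ.slice Lᶜ X'' := slice_ext t.rotate hX
    (slice_shift_one (fun φ hφ hφ' => hφ.2 (hL (by linarith) hφ')) (slice_of_hasHN h'))
  have h0 : IsZero X'' := isZero_of_slice (J := I ∩ L) (fun φ hφ ψ hψ => by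
    by_contra! hle
    exact hφ (hL hle hψ.2)) hX'' (slice_of_hasHN h'')
  obtain ⟨e⟩ := t.nonempty_iso₁₂ h0
  exact h'.of_iso e

/-- Not formal, since slices are extension closures: the filtration of `X` itself has to be confined
to `M \ L`. -/
theorem slice_inter {L M : Set ℝ} (hL : IsLowerSet L) (hM : IsLowerSet M)
    (hX : σ.slice Lᶜ X) (hX' : σ.slice M X) : σ.slice (M \ L) X :=
  slice_of_hasHN ((hasHN_diff (hasHN_inter (σ.hasHN X) hM hX') hL hX).mono
    (Set.sdiff_subset_sdiff_left Set.inter_subset_right))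

/-- Membership in the heart is verified below one half-line at a time, by extensions and shifts. -/
theorem heart_iff : σ.heart X ↔ σ.slice (Set.Ioi 0) X ∧ σ.slice (Set.Iic 1) X := by
  refine ⟨fun h => ⟨slice_mono (fun _ h => h.1) h, slice_mono (fun _ h => h.2) h⟩, fun h => ?_⟩
  refine slice_mono ?_ (slice_inter (isLowerSet_Iic 0) (isLowerSet_Iic 1) (M := Set.Iic 1)
    (L := Set.Iic 0) (by simpa using h.1) h.2)
  rintro x ⟨h₁, h₂⟩
  exact ⟨not_le.1 h₂, h₁⟩

theorem free_of_slice (h₁ : σ.slice (Set.Ioi 0) X) (h₂ : σ.slice (Set.Iio 1) X) : σ.free X := by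
  refine slice_mono ?_ (slice_inter (isLowerSet_Iic 0) (isLowerSet_Iio 1) (M := Set.Iio 1)
    (L := Set.Iic 0) (by simpa using h₁) h₂)
  rintro x ⟨h₁, h₂⟩
  exact ⟨not_le.1 h₂, h₁⟩

end StabilityCondition

namespace StabilityCondition

variable {σ : StabilityCondition D} {X Y Z : D}

theorem heart_of_free (h : σ.free X) : σ.heart X :=
  slice_mono (fun _ h => ⟨h.1, h.2.le⟩) h

theorem Z_of_distTri (σ : StabilityCondition D) (h : DistTri X Y Z) :
    σ.Z (K0.of Y) = σ.Z (K0.of X) + σ.Z (K0.of Z) := by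
  rw [h.K0_of, map_add]

theorem Z_of_isZero (σ : StabilityCondition D) (h : IsZero X) : σ.Z (K0.of X) = 0 := by
  rw [K0.of_isZero h, map_zero]

theorem exists_re_im_eq {φ : ℝ} (hX : σ.P φ X) (h0 : ¬ IsZero X) :
    ∃ m : ℝ, 0 < m ∧ (σ.Z (K0.of X)).re = m * Real.cos (Real.pi * φ) ∧
      (σ.Z (K0.of X)).im = m * Real.sin (Real.pi * φ) := by
  obtain ⟨m, hm, h⟩ := σ.charge φ X hX h0
  refine ⟨m, hm, ?_⟩
  rw [h, ← Complex.ofReal_mul Real.pi φ, Complex.re_ofReal_mul, Complex.im_ofReal_mul,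
    Complex.exp_ofReal_mul_I_re, Complex.exp_ofReal_mul_I_im]
  exact ⟨rfl, rfl⟩

theorem im_pos_of_free (h : σ.free X) : IsZero X ∨ 0 < (σ.Z (K0.of X)).im := by
  refine slice_induction (fun X => IsZero X ∨ 0 < (σ.Z (K0.of X)).im) (fun _ => Or.inl) ?_ ?_ h
  · intro X φ hφ hX
    by_cases h0 : IsZero X
    · exact Or.inl h0
    · obtain ⟨m, hm, -, h⟩ := exists_re_im_eq hX h0
      rw [h]
      refine Or.inr (mul_pos hm (Real.sin_pos_of_pos_of_lt_pi (mul_pos Real.pi_pos hφ.1) ?_))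
      nlinarith [Real.pi_pos, hφ.2]
  · intro X Y Z t hX hZ
    rw [σ.Z_of_distTri t, Complex.add_im]
    rcases hX with hX | hX <;> rcases hZ with hZ | hZ
    · exact Or.inl (t.isZero₂ hX hZ)
    · rw [σ.Z_of_isZero hX]
      exact Or.inr (by simpa using hZ)
    · rw [σ.Z_of_isZero hZ]
      exact Or.inr (by simpa using hX)
    · exact Or.inr (add_pos hX hZ)

theorem im_nonneg_of_heart (h : σ.heart X) :
    0 ≤ (σ.Z (K0.of X)).im ∧ ((σ.Z (K0.of X)).im = 0 → (σ.Z (K0.of X)).re ≤ 0) := by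
  refine slice_induction (fun X => 0 ≤ (σ.Z (K0.of X)).im ∧
    ((σ.Z (K0.of X)).im = 0 → (σ.Z (K0.of X)).re ≤ 0)) (fun X hX => ?_) ?_ ?_ h
  · simp [σ.Z_of_isZero hX]
  · intro X φ hφ hX
    by_cases h0 : IsZero X
    · simp [σ.Z_of_isZero h0]
    · obtain ⟨m, hm, hre, him⟩ := exists_re_im_eq hX h0
      rw [him, hre]
      rcases hφ.2.eq_or_lt with rfl | hlt
      · simp [hm.le]
      · have : 0 < m * Real.sin (Real.pi * φ) := by
          refine mul_pos hm (Real.sin_pos_of_pos_of_lt_pi (mul_pos Real.pi_pos hφ.1) ?_)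
          nlinarith [Real.pi_pos]
        exact ⟨this.le, fun h => absurd h this.ne'⟩
  · intro X Y Z t hX hZ
    rw [σ.Z_of_distTri t, Complex.add_im, Complex.add_re]
    exact ⟨add_nonneg hX.1 hZ.1, fun h => add_nonpos (hX.2 (by linarith [hX.1, hZ.1]))
      (hZ.2 (by linarith [hX.1, hZ.1]))⟩

end StabilityCondition

end Filtrations

/-! ### The gluing functor: its triangle, and reflection of the t-structure -/

section Gluing

variable {D D₁ D₂ C : Type*}
  [Category D] [HasZeroObject D] [Preadditive D] [HasShift D ℤ]
  [∀ n : ℤ, (shiftFunctor D n).Additive] [Pretriangulated D]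
  [Category D₁] [HasZeroObject D₁] [Preadditive D₁] [HasShift D₁ ℤ]
  [∀ n : ℤ, (shiftFunctor D₁ n).Additive] [Pretriangulated D₁]
  [Category D₂] [HasZeroObject D₂] [Preadditive D₂] [HasShift D₂ ℤ]
  [∀ n : ℤ, (shiftFunctor D₂ n).Additive] [Pretriangulated D₂]
  [Category C]

theorem DistTri.nonempty_iso₃ {X Y Z X' Y' Z' : D} {f : X ⟶ Y} {g : Y ⟶ Z} {h : Z ⟶ X⟦(1 : ℤ)⟧}
    {f' : X' ⟶ Y'} {g' : Y' ⟶ Z'} {h' : Z' ⟶ X'⟦(1 : ℤ)⟧}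
    (hT : Triangle.mk f g h ∈ distTriang D) (hT' : Triangle.mk f' g' h' ∈ distTriang D)
    (e₁ : X ≅ X') (e₂ : Y ≅ Y') (comm : f ≫ e₂.hom = e₁.hom ≫ f') : Nonempty (Z ≅ Z') :=
  ⟨Triangle.π₃.mapIso (isoTriangleOfIso₁₂ _ _ hT hT' e₁ e₂ comm)⟩

namespace SOD

variable {S : SOD D D₁ D₂}

theorem distTri (S : SOD D D₁ D₂) (E : D) :
    DistTri (S.i₂.obj (S.τ₂R.obj E)) E (S.i₁.obj (S.τ₁L.obj E)) :=
  ⟨_, _, (S.triangle E).choose, (S.triangle E).choose_spec⟩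

/-- The isomorphism `τ₁L i₁ X ≅ X`. -/
def τ₁LI₁ (S : SOD D D₁ D₂) (X : D₁) : S.τ₁L.obj (S.i₁.obj X) ≅ X :=
  (asIso S.adj₁.counit).app X

/-- The isomorphism `X ≅ τ₂R i₂ X`. -/
def τ₂RI₂ (S : SOD D D₁ D₂) (X : D₂) : X ≅ S.τ₂R.obj (S.i₂.obj X) :=
  (asIso S.adj₂.unit).app X

theorem isZero_iff (S : SOD D D₁ D₂) {E : D} (h₁ : IsZero (S.τ₁L.obj E))
    (h₂ : IsZero (S.τ₂R.obj E)) : IsZero E :=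
  (S.distTri E).isZero₂ (S.i₂.map_isZero h₂) (S.i₁.map_isZero h₁)

section

variable {σ₁ : StabilityCondition D₁} {σ₂ : StabilityCondition D₂} {β ω : ℝ} {X Y Z : D}

theorem gluedHeart_ext (h : DistTri X Y Z) (hX : S.gluedHeart σ₁ σ₂ X)
    (hZ : S.gluedHeart σ₁ σ₂ Z) : S.gluedHeart σ₁ σ₂ Y :=
  ⟨StabilityCondition.slice_ext (h.map S.τ₁L) hX.1 hZ.1,
    StabilityCondition.slice_ext (h.map S.τ₂R) hX.2 hZ.2⟩

theorem gluedHeart_of_isZero (hX : IsZero X) : S.gluedHeart σ₁ σ₂ X :=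
  ⟨σ₁.slice_of_isZero (S.τ₁L.map_isZero hX), σ₂.slice_of_isZero (S.τ₂R.map_isZero hX)⟩

theorem gluedFree_of_isZero (hX : IsZero X) : S.gluedFree σ₁ σ₂ X :=
  ⟨gluedHeart_of_isZero hX, σ₁.slice_of_isZero (S.τ₁L.map_isZero hX),
    σ₂.slice_of_isZero (S.τ₂R.map_isZero hX)⟩

theorem gluedFree_ext (h : DistTri X Y Z) (hX : S.gluedFree σ₁ σ₂ X)
    (hZ : S.gluedFree σ₁ σ₂ Z) : S.gluedFree σ₁ σ₂ Y :=
  ⟨gluedHeart_ext h hX.1 hZ.1, StabilityCondition.slice_ext (h.map S.τ₁L) hX.2.1 hZ.2.1,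
    StabilityCondition.slice_ext (h.map S.τ₂R) hX.2.2 hZ.2.2⟩

end

namespace CondOne

variable (c : S.CondOne)

instance : c.τ₁R.CommShift ℤ := c.adj.rightAdjointCommShift ℤ

instance : c.adj.CommShift ℤ := c.adj.commShift_of_leftAdjoint ℤ

instance : c.τ₁R.IsTriangulated := c.adj.isTriangulated_rightAdjoint

/-- The isomorphism `X ≅ τ₁R i₁ X`. -/
def τ₁RI₁ (X : D₁) : X ≅ c.τ₁R.obj (S.i₁.obj X) :=
  (asIso c.adj.unit).app X

/-- The functor `τ₁R i₂`, which is the shift of the gluing functor by `-1`. -/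
abbrev V : D₂ ⥤ D₁ := S.i₂ ⋙ c.τ₁R

/-- The image under τ₁R of the triangle of the decomposition. Rotated, it exhibits τ₁R E as the
fibre of the gluing map τ₁L E ⟶ Φ(τ₂R E), where Φ is `V` followed by the shift. -/
theorem distTri (E : D) :
    DistTri (c.V.obj (S.τ₂R.obj E)) (c.τ₁R.obj E) (S.τ₁L.obj E) :=
  ((S.distTri E).map c.τ₁R).congr (Iso.refl _) (Iso.refl _) (c.τ₁RI₁ _).symm

variable {c} {σ₁ : StabilityCondition D₁} {σ₂ : StabilityCondition D₂}

theorem V_slice_Ioi (h : S.CondThree σ₁ σ₂ c) {X : D₂} (hX : σ₂.slice (Set.Ioi 0) X) :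
    σ₁.slice (Set.Ioi (-1)) (c.V.obj X) :=
  StabilityCondition.slice_of_shift_one (fun φ hφ => by
    simp only [Set.mem_Ioi] at hφ ⊢
    linarith) (h.1 X hX)

theorem V_slice_Iic (h : S.CondThree σ₁ σ₂ c) {X : D₂} (hX : σ₂.slice (Set.Iic 1) X) :
    σ₁.slice (Set.Iic 0) (c.V.obj X) :=
  StabilityCondition.slice_of_shift_one (fun φ hφ => by
    simp only [Set.mem_Iic] at hφ ⊢
    linarith) (h.2 X hX)

end CondOne

namespace CondTwo

variable (c : S.CondTwo C)

/-- The left adjoint of `i₂`. -/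
def L : D ⥤ D₂ := c.τ₁R ⋙ c.e₁.functor ⋙ c.e₂.inverse

/-- The adjunction between `L` and `i₂`. -/
def adjLI₂ : c.L ⊣ S.i₂ := c.adjL

instance : c.L.CommShift ℤ := c.adjLI₂.leftAdjointCommShift ℤ

instance : c.adjLI₂.CommShift ℤ := c.adjLI₂.commShift_of_rightAdjoint ℤ

instance : c.L.IsTriangulated := c.adjLI₂.isTriangulated_leftAdjoint

theorem isZero_L_iff (E : D) : IsZero (c.L.obj E) ↔ IsZero (c.τ₁R.obj E) := by
  let F : D₁ ≌ D₂ := c.e₁.trans c.e₂.symm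
  refine ⟨fun h => ?_, fun h => F.functor.map_isZero h⟩
  exact (F.inverse.map_isZero h).of_iso (F.unitIso.app (c.τ₁R.obj E))

/-- As i₂ is fully faithful, the counit L i₂ X ⟶ X is invertible, and L is τ₁R followed by an
equivalence. This conservativity is what makes the t-exact functor Φ reflect hearts. -/
theorem isZero_of_isZero_V {X : D₂} (h : IsZero (c.V.obj X)) : IsZero X :=
  ((c.isZero_L_iff _).2 h).of_iso ((asIso c.adjLI₂.counit).app X).symm

variable {c} {σ₁ : StabilityCondition D₁} {σ₂ : StabilityCondition D₂}

/-- The truncation of `X` to phases above 1 has an image under `V` with phases both above 0 and at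
most 0. So the image is zero, and by conservativity the truncation is zero. -/
theorem slice_Iic_of_V [IsTriangulated D₂] (h : S.CondThree σ₁ σ₂ c.toCondOne) {X : D₂}
    (hX : σ₁.slice (Set.Iic 0) (c.V.obj X)) : σ₂.slice (Set.Iic 1) X := by
  obtain ⟨X', X'', t, h', h''⟩ := σ₂.exists_truncation X (isLowerSet_Iic 1)
  have h₁ : σ₁.slice (Set.Iic 0) (c.V.obj X') := by
    refine StabilityCondition.slice_ext (t.map c.V).invRotate
      (StabilityCondition.slice_shift_neg_one ?_ (CondOne.V_slice_Iic h h'')) hX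
    intro φ hφ
    simp only [Set.mem_Iic] at hφ ⊢
    linarith
  have h₂ : σ₁.slice (Set.Ioi 0) (c.V.obj X') := by
    have h₃ : σ₁.slice (Set.Ioi (-1)) (c.V.obj (X'⟦(-1 : ℤ)⟧)) :=
      CondOne.V_slice_Ioi h (StabilityCondition.slice_shift_neg_one (fun φ hφ => by
        simp only [Set.mem_Ioi, Set.mem_compl_iff, Set.mem_Iic] at hφ ⊢
        linarith) h')
    have h₄ := StabilityCondition.slice_shift_one (J := Set.Ioi 0) (fun φ hφ => by
      simp only [Set.mem_Ioi] at hφ ⊢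
      linarith) h₃
    exact StabilityCondition.slice_of_iso ((c.V.commShiftIso (1 : ℤ)).symm.app _ ≪≫
      c.V.mapIso ((shiftEquiv D₂ (1 : ℤ)).counitIso.app X')) h₄
  have h0 := c.isZero_of_isZero_V (StabilityCondition.isZero_of_slice
    (fun φ hφ ψ hψ => lt_of_le_of_lt hψ hφ) h₂ h₁)
  obtain ⟨e⟩ := t.nonempty_iso₂₃ h0
  exact StabilityCondition.slice_of_iso e.symm h''

theorem slice_Ioi_of_V [IsTriangulated D₂] (h : S.CondThree σ₁ σ₂ c.toCondOne) {X : D₂}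
    (hX : σ₁.slice (Set.Ioi (-1)) (c.V.obj X)) : σ₂.slice (Set.Ioi 0) X := by
  obtain ⟨X', X'', t, h', h''⟩ := σ₂.exists_truncation X (isLowerSet_Iic 0)
  rw [Set.compl_Iic] at h'
  have h₁ : σ₁.slice (Set.Ioi (-1)) (c.V.obj X'') := by
    refine StabilityCondition.slice_ext (t.map c.V).rotate hX
      (StabilityCondition.slice_shift_one ?_ (CondOne.V_slice_Ioi h h'))
    intro φ hφ
    simp only [Set.mem_Ioi] at hφ ⊢
    linarith
  have h₂ : σ₁.slice (Set.Iic (-1)) (c.V.obj X'') := by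
    have h₃ : σ₁.slice (Set.Iic 0) (c.V.obj (X''⟦(1 : ℤ)⟧)) :=
      CondOne.V_slice_Iic h (StabilityCondition.slice_shift_one (fun φ hφ => by
        simp only [Set.mem_Iic] at hφ ⊢
        linarith) h'')
    refine StabilityCondition.slice_of_shift_one (fun φ hφ => ?_)
      (StabilityCondition.slice_of_iso ((c.V.commShiftIso (1 : ℤ)).app _) h₃)
    simp only [Set.mem_Iic] at hφ ⊢
    linarith
  have h0 := c.isZero_of_isZero_V (StabilityCondition.isZero_of_slice
    (fun φ hφ ψ hψ => lt_of_le_of_lt hψ hφ) h₁ h₂)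
  obtain ⟨e⟩ := t.nonempty_iso₁₂ h0
  exact StabilityCondition.slice_of_iso e h'

theorem heart_of_V [IsTriangulated D₂] (h : S.CondThree σ₁ σ₂ c.toCondOne) {X : D₂}
    (hX : σ₁.slice (Set.Ioi (-1)) (c.V.obj X)) (hX' : σ₁.slice (Set.Iic 0) (c.V.obj X)) :
    σ₂.heart X :=
  StabilityCondition.heart_iff.2 ⟨slice_Ioi_of_V h hX, slice_Iic_of_V h hX'⟩

end CondTwo

end SOD

end Gluing

/-! ### Test subobjects and the quadratic inequality -/

section Slope

variable {D D₁ D₂ C : Type*}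
  [Category D] [HasZeroObject D] [Preadditive D] [HasShift D ℤ]
  [∀ n : ℤ, (shiftFunctor D n).Additive] [Pretriangulated D]
  [Category D₁] [HasZeroObject D₁] [Preadditive D₁] [HasShift D₁ ℤ]
  [∀ n : ℤ, (shiftFunctor D₁ n).Additive] [Pretriangulated D₁]
  [Category D₂] [HasZeroObject D₂] [Preadditive D₂] [HasShift D₂ ℤ]
  [∀ n : ℤ, (shiftFunctor D₂ n).Additive] [Pretriangulated D₂]
  [Category C]

namespace SOD

variable {S : SOD D D₁ D₂} {σ₁ : StabilityCondition D₁} {σ₂ : StabilityCondition D₂} {β ω : ℝ}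

variable (S σ₁ σ₂) in
/-- The central charge of the component of `E` in `D₁`. -/
def z₁ (E : D) : ℂ := σ₁.Z (K0.of (S.τ₁L.obj E))

variable (S σ₁ σ₂) in
/-- The central charge of the component of `E` in `D₂`. -/
def z₂ (E : D) : ℂ := σ₂.Z (K0.of (S.τ₂R.obj E))

theorem z₂_of_distTri {X Y Z : D} (h : DistTri X Y Z) :
    S.z₂ σ₂ Y = S.z₂ σ₂ X + S.z₂ σ₂ Z :=
  σ₂.Z_of_distTri (h.map S.τ₂R)

theorem z₁_of_isZero {X : D} (h : IsZero X) : S.z₁ σ₁ X = 0 :=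
  σ₁.Z_of_isZero (S.τ₁L.map_isZero h)

theorem z₂_of_isZero {X : D} (h : IsZero X) : S.z₂ σ₂ X = 0 :=
  σ₂.Z_of_isZero (S.τ₂R.map_isZero h)

/-- The inclusion of the kernel of the gluing map of a free object of the glued heart. -/
theorem exists_kernel [IsTriangulated D₁] [IsTriangulated D₂] (c : S.CondOne) (h : S.CondThree σ₁ σ₂ c) {G : D}
    (hG : S.gluedFree σ₁ σ₂ G) :
    ∃ K R : D₁, DistTri K (c.τ₁R.obj G) R ∧ σ₁.free K ∧ σ₁.slice (Set.Iic 0) R ∧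
      IsSubobjectIn (S.gluedHeart σ₁ σ₂) (S.i₁.obj K) G := by
  obtain ⟨K, R, ⟨k, r, δ, hT⟩, hK, hR⟩ :=
    σ₁.exists_truncation (c.τ₁R.obj G) (isLowerSet_Iic 0)
  rw [Set.compl_Iic] at hK
  have t : DistTri K (c.τ₁R.obj G) R := ⟨k, r, δ, hT⟩
  have hτ : σ₁.slice (Set.Iio 1) (c.τ₁R.obj G) := by
    refine StabilityCondition.slice_ext (c.distTri G)
      (StabilityCondition.slice_mono ?_ (CondOne.V_slice_Iic h
        (StabilityCondition.heart_iff.1 hG.1.2).2)) ?_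
    · intro φ hφ
      simp only [Set.mem_Iic, Set.mem_Iio] at hφ ⊢
      linarith
    · exact StabilityCondition.slice_mono (fun φ hφ => hφ.2) hG.2.1
  have hK₁ : σ₁.slice (Set.Iio 1) K := by
    refine StabilityCondition.slice_ext t.invRotate
      (StabilityCondition.slice_shift_neg_one ?_ hR) hτ
    intro φ hφ
    simp only [Set.mem_Iic, Set.mem_Iio] at hφ ⊢
    linarith
  have hKf : σ₁.free K := StabilityCondition.free_of_slice hK hK₁
  -- The inclusion is the adjoint i₁K ⟶ G of `k`. Applying τ₁R to it gives back `k`, so the cone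
  -- `G'` satisfies τ₁R G' ≅ `R`; this bounds the phases of τ₁L G' from above.
  obtain ⟨G', p, q, hT'⟩ := distinguished_cocone_triangle ((c.adj.homEquiv K G).symm k)
  have t' : DistTri (S.i₁.obj K) G G' := ⟨_, _, _, hT'⟩
  have hcomm : k ≫ (Iso.refl _).hom =
      (c.τ₁RI₁ K).hom ≫ c.τ₁R.map ((c.adj.homEquiv K G).symm k) := by
    have h₁ := (c.adj.homEquiv K G).apply_symm_apply k
    rw [Adjunction.homEquiv_unit] at h₁
    rw [Iso.refl_hom, Category.comp_id]
    exact h₁.symm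
  obtain ⟨e⟩ := DistTri.nonempty_iso₃ hT (c.τ₁R.map_distinguished _ hT') (c.τ₁RI₁ K)
    (Iso.refl _) hcomm
  obtain ⟨e₂⟩ := (t'.map S.τ₂R).nonempty_iso₂₃ (S.τ₂R_i₁ K)
  have hG'₂ : σ₂.heart (S.τ₂R.obj G') := StabilityCondition.slice_of_iso e₂ hG.1.2
  have t₁ : DistTri K (S.τ₁L.obj G) (S.τ₁L.obj G') :=
    (t'.map S.τ₁L).congr (S.τ₁LI₁ K) (Iso.refl _) (Iso.refl _)
  have hJ₀ : σ₁.slice (Set.Ioi 0) (S.τ₁L.obj G') := by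
    refine StabilityCondition.slice_ext t₁.rotate (StabilityCondition.heart_iff.1 hG.1.1).1
      (StabilityCondition.slice_shift_one ?_ hK)
    intro φ hφ
    simp only [Set.mem_Ioi] at hφ ⊢
    linarith
  have hJ₁ : σ₁.slice (Set.Iic 1) (S.τ₁L.obj G') := by
    refine StabilityCondition.slice_ext (c.distTri G').rotate
      (StabilityCondition.slice_of_iso e (StabilityCondition.slice_mono ?_ hR))
      (StabilityCondition.slice_shift_one ?_ (CondOne.V_slice_Iic h
        (StabilityCondition.heart_iff.1 hG'₂).2))
    · exact Set.Iic_subset_Iic.2 zero_le_one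
    · intro φ hφ
      simp only [Set.mem_Iic] at hφ ⊢
      linarith
  refine ⟨K, R, t, hKf, hR, ⟨?_, ?_⟩, G', _, _, _,
    ⟨StabilityCondition.heart_iff.2 ⟨hJ₀, hJ₁⟩, hG'₂⟩, hT'⟩
  · exact StabilityCondition.slice_of_iso (S.τ₁LI₁ K).symm (StabilityCondition.heart_of_free hKf)
  · exact σ₂.slice_of_isZero (S.τ₂R_i₁ K)

/-- If the gluing map of an object `G` of the glued heart is injective, then its first component
embeds diagonally. -/
theorem exists_diagonal [IsTriangulated D₁] [IsTriangulated D₂] (c : S.CondTwo C)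
    (h : S.CondFive σ₁ σ₂ c.toCondOne) {G : D} (hG : S.gluedHeart σ₁ σ₂ G)
    (hR : σ₁.slice (Set.Iic 0) (c.τ₁R.obj G)) :
    (S.z₁ σ₁ G).im ≤ (S.z₂ σ₂ G).im ∧
      ∃ H : D, IsSubobjectIn (S.gluedHeart σ₁ σ₂) H G ∧ S.z₁ σ₁ H = S.z₁ σ₁ G ∧
        S.z₂ σ₂ H = S.z₁ σ₁ G := by
  have h₃ := h.1.1
  have hR' : σ₁.slice (Set.Ioi (-1)) (c.τ₁R.obj G) := by
    refine StabilityCondition.slice_ext (c.distTri G)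
      (CondOne.V_slice_Ioi h₃ (StabilityCondition.heart_iff.1 hG.2).1)
      (StabilityCondition.slice_mono ?_ (StabilityCondition.heart_iff.1 hG.1).1)
    exact Set.Ioi_subset_Ioi (by norm_num)
  -- `H` is the fibre of the unit G ⟶ i₂ L G. By a triangle identity L inverts the unit, so L H = 0
  -- and hence τ₁R H = 0.
  obtain ⟨H, f, g, hT⟩ := distinguished_cocone_triangle₁ (c.adjLI₂.unit.app G)
  have t : DistTri H G (S.i₂.obj (c.L.obj G)) := ⟨_, _, _, hT⟩
  have hiso : IsIso (c.L.map (c.adjLI₂.unit.app G)) := by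
    have h₁ := c.adjLI₂.left_triangle_components G
    rw [IsIso.eq_inv_of_inv_hom_id h₁]
    infer_instance
  have hLH : IsZero (c.L.obj H) :=
    Triangle.isZero₁_of_isIso₂ _ (c.L.map_distinguished _ hT) hiso
  have hH : IsZero (c.τ₁R.obj H) := (c.isZero_L_iff H).1 hLH
  obtain ⟨e⟩ := (t.map c.τ₁R).nonempty_iso₂₃ hH
  have hLG : σ₂.heart (c.L.obj G) := CondTwo.heart_of_V h₃
    (StabilityCondition.slice_of_iso e hR') (StabilityCondition.slice_of_iso e hR)
  obtain ⟨e₁⟩ := (t.map S.τ₁L).nonempty_iso₁₂ (S.τ₁L_i₂ _)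
  -- Since its fibre τ₁R H vanishes, the gluing map of `H` is an isomorphism τ₁L H ≅ Φ(τ₂R H); with
  -- Z₂ = Z₁ ∘ Φ on the heart, both charges of `H` agree.
  obtain ⟨e₂⟩ := (c.distTri H).nonempty_iso₃₁ hH
  have hH₁ : σ₁.heart (S.τ₁L.obj H) := StabilityCondition.slice_of_iso e₁.symm hG.1
  have hH₁' := StabilityCondition.heart_iff.1 (StabilityCondition.slice_of_iso e₂ hH₁)
  have hH₂ : σ₂.heart (S.τ₂R.obj H) := by
    refine CondTwo.heart_of_V h₃ (StabilityCondition.slice_of_shift_one ?_ hH₁'.1)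
      (StabilityCondition.slice_of_shift_one ?_ hH₁'.2)
    · intro φ hφ
      simp only [Set.mem_Ioi] at hφ ⊢
      linarith
    · intro φ hφ
      simp only [Set.mem_Iic] at hφ ⊢
      linarith
  have hz₁ : S.z₁ σ₁ H = S.z₁ σ₁ G := by rw [z₁, z₁, K0.of_iso e₁]
  have hz₂ : S.z₂ σ₂ H = S.z₁ σ₁ G := by
    rw [← hz₁, z₁, K0.of_iso e₂]
    exact h.2 _ hH₂
  refine ⟨?_, H, ⟨⟨hH₁, hH₂⟩, _, _, _, _, ⟨?_, ?_⟩, hT⟩, hz₁, hz₂⟩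
  · have h₁ : S.z₂ σ₂ (S.i₂.obj (c.L.obj G)) = σ₂.Z (K0.of (c.L.obj G)) := by
      rw [z₂, K0.of_iso (S.τ₂RI₂ (c.L.obj G))]
    rw [z₂_of_distTri t, hz₂, h₁, Complex.add_im]
    linarith [(StabilityCondition.im_nonneg_of_heart hLG).1]
  · exact σ₁.slice_of_isZero (S.τ₁L_i₂ _)
  · exact StabilityCondition.slice_of_iso (S.τ₂RI₂ (c.L.obj G)) hLG

theorem slope_eq (E : D) : S.slope σ₁ σ₂ β ω E =
    ((S.z₁ σ₁ E).im - ω * (S.z₂ σ₂ E).re + β * (S.z₂ σ₂ E).im) /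
      ((S.z₁ σ₁ E).im + (S.z₂ σ₂ E).im) := rfl

theorem im_nonneg_of_gluedHeart {G : D} (hG : S.gluedHeart σ₁ σ₂ G) :
    0 ≤ (S.z₁ σ₁ G).im ∧ 0 ≤ (S.z₂ σ₂ G).im :=
  ⟨(StabilityCondition.im_nonneg_of_heart hG.1).1, (StabilityCondition.im_nonneg_of_heart hG.2).1⟩

theorem im_pos_of_gluedFree {G : D} (hG : S.gluedFree σ₁ σ₂ G) (h0 : ¬ IsZero G) :
    0 < (S.z₁ σ₁ G).im + (S.z₂ σ₂ G).im := by
  have hn := im_nonneg_of_gluedHeart hG.1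
  rcases StabilityCondition.im_pos_of_free hG.2.1 with h₁ | h₁
  · rcases StabilityCondition.im_pos_of_free hG.2.2 with h₂ | h₂
    · exact absurd (S.isZero_iff h₁ h₂) h0
    · exact add_pos_of_nonneg_of_pos hn.1 h₂
  · exact add_pos_of_pos_of_nonneg h₁ hn.2

/-- The Bogomolov-Gieseker type inequality for semistable free objects of slope less than one. -/
theorem bogomolov_inequality [IsTriangulated D₁] [IsTriangulated D₂] (c : S.CondTwo C)
    (hω : 0 < ω) (h : S.CondFive σ₁ σ₂ c.toCondOne) {G : D} {s : ℝ}
    (hG : S.slopeSemistable σ₁ σ₂ β ω s G) (hs : s < 1) :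
    (S.z₁ σ₁ G).im ≤ (S.z₂ σ₂ G).im ∧
      (S.z₁ σ₁ G).im * (S.z₂ σ₂ G).re ≤ (S.z₁ σ₁ G).re * (S.z₂ σ₂ G).im := by
  obtain ⟨hfree, h0, hslope, hsub⟩ := hG
  rw [hslope] at hsub
  obtain ⟨K, R, t, hK, hR, hKG⟩ := exists_kernel c.toCondOne h.1.1 hfree
  -- The component of i₁K in D₂ is zero, so a nonzero `K` would give a subobject of slope 1 > s.
  have hK0 : IsZero K := by
    by_contra hK0
    have hKpos := (StabilityCondition.im_pos_of_free hK).resolve_left hK0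
    have hz₁ : S.z₁ σ₁ (S.i₁.obj K) = σ₁.Z (K0.of K) := by rw [z₁, K0.of_iso (S.τ₁LI₁ K)]
    have hz₂ : S.z₂ σ₂ (S.i₁.obj K) = 0 := σ₂.Z_of_isZero (S.τ₂R_i₁ K)
    have h₁ := hsub (S.i₁.obj K)
      (fun hz => hK0 ((S.τ₁L.map_isZero hz).of_iso (S.τ₁LI₁ K).symm)) hKG
    rw [slope_eq, hz₁, hz₂] at h₁
    simp only [Complex.zero_re, Complex.zero_im, mul_zero, sub_zero, add_zero] at h₁
    rw [div_self hKpos.ne'] at h₁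
    linarith
  obtain ⟨e⟩ := t.nonempty_iso₂₃ hK0
  obtain ⟨hle, H, hHG, hz₁, hz₂⟩ := exists_diagonal c h hfree.1
    (StabilityCondition.slice_of_iso e.symm hR)
  refine ⟨hle, ?_⟩
  have hn := im_nonneg_of_gluedHeart hfree.1
  have hpos := im_pos_of_gluedFree hfree h0
  rcases StabilityCondition.im_pos_of_free hfree.2.1 with h₁ | h₁
  · have hz : S.z₁ σ₁ G = 0 := σ₁.Z_of_isZero h₁
    simp [hz]
  · change 0 < (S.z₁ σ₁ G).im at h₁
    have hH0 : ¬ IsZero H := fun hz => by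
      rw [← hz₁, z₁_of_isZero hz] at h₁
      simp at h₁
    have h₂ := hsub H hH0 hHG
    rw [slope_eq] at hslope
    rw [slope_eq, hz₁, hz₂, div_le_iff₀ (by linarith)] at h₂
    rw [div_eq_iff hpos.ne'] at hslope
    generalize (S.z₁ σ₁ G).im = b₁ at *
    generalize (S.z₁ σ₁ G).re = a₁ at *
    generalize (S.z₂ σ₂ G).im = b₂ at *
    generalize (S.z₂ σ₂ G).re = a₂ at *
    -- Eliminating β between the slope comparison times b₂ and the equation for `s` times b₁ leaves
    -- ω(a₁b₂ - b₁a₂) ≥ (1 - s) b₁ (b₂ - b₁) ≥ 0.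
    have h₃ := mul_le_mul_of_nonneg_left h₂ hn.2
    have h₄ := mul_nonneg h₁.le (mul_nonneg (sub_nonneg.2 hle) (sub_nonneg.2 hs.le))
    have h₅ : ω * (b₁ * a₂) ≤ ω * (a₁ * b₂) := by linear_combination h₃ + h₄ - b₁ * hslope
    exact le_of_mul_le_mul_left h₅ hω

end SOD

end Slope

/-! ### Inequalities between real and complex numbers -/

/-- The difference of the two sides is ‖z‖ ‖w‖ sin(arg w - arg z), and the angle lies in [0, π].
This form of the comparison of phases needs no division by imaginary parts. -/
theorem re_mul_im_le_of_arg_le {z w : ℂ} (hz : 0 ≤ z.im)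
    (h : Complex.arg z ≤ Complex.arg w) : w.re * z.im ≤ z.re * w.im := by
  have hs : 0 ≤ Real.sin (w.arg - z.arg) := by
    refine Real.sin_nonneg_of_nonneg_of_le_pi (sub_nonneg.2 h) ?_
    linarith [Complex.arg_le_pi w, Complex.arg_nonneg_iff.2 hz]
  have h' : z.re * w.im - w.re * z.im = ‖z‖ * ‖w‖ * Real.sin (w.arg - z.arg) := by
    rw [Real.sin_sub, ← Complex.norm_mul_cos_arg z, ← Complex.norm_mul_sin_arg z,
      ← Complex.norm_mul_cos_arg w, ← Complex.norm_mul_sin_arg w]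
    ring
  have := mul_nonneg (mul_nonneg (norm_nonneg z) (norm_nonneg w)) hs
  linarith

theorem K0.of_shift_eq_or {D : Type*} [Category D] [HasZeroObject D] [Preadditive D]
    [HasShift D ℤ] [∀ n : ℤ, (shiftFunctor D n).Additive] [Pretriangulated D] (E : D) (n : ℤ) :
    K0.of (E⟦n⟧) = K0.of E ∨ K0.of (E⟦n⟧) = -K0.of E := by
  have h₀ : K0.of (E⟦(0 : ℤ)⟧) = K0.of E := K0.of_iso ((shiftFunctorZero D ℤ).app E)
  have h₁ : ∀ m : ℤ, K0.of (E⟦m + 1⟧) = -K0.of (E⟦m⟧) := fun m => by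
    rw [K0.of_iso ((shiftFunctorAdd D m 1).app E)]
    exact K0.of_shift_one _
  induction n with
  | zero => exact Or.inl h₀
  | succ k ih =>
    rw [h₁, neg_inj, neg_eq_iff_eq_neg]
    exact ih.symm
  | pred k ih =>
    have h₂ := h₁ (-(k : ℤ) - 1)
    rw [sub_add_cancel, eq_neg_iff_add_eq_zero, add_comm, ← eq_neg_iff_add_eq_zero] at h₂
    rw [h₂, neg_inj, neg_eq_iff_eq_neg]
    exact ih.symm

theorem norm_map_K0_shift {D : Type*} [Category D] [HasZeroObject D] [Preadditive D]
    [HasShift D ℤ] [∀ n : ℤ, (shiftFunctor D n).Additive] [Pretriangulated D] (f : K0 D →+ ℂ)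
    (E : D) (n : ℤ) : ‖f (K0.of (E⟦n⟧))‖ = ‖f (K0.of E)‖ := by
  rcases K0.of_shift_eq_or E n with h | h <;> simp [h]

/-- The constant `(|β| + 1) / ω`. -/
def slopeConst (β ω : ℝ) : ℝ := (|β| + 1) / ω

/-- Put s = b₁ + βb₂ and i = s - ωa₂, the imaginary part of Z. The hypothesis gives (a₁ + βa₂) b₂ ≥
s a₂, and ω s a₂ = s² - s i ≥ -|s||i| with |s| ≤ (|β| + 1) b₂. Dividing by b₂ bounds ωb₂ by Re Z +
l|i|, where l = `slopeConst β ω`; then ωa₂ = s - i bounds a₂. -/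
theorem norm_le_of_mul_le_mul {β ω a₁ a₂ b₁ b₂ : ℝ} (hω : 0 < ω) (hb₁ : 0 ≤ b₁) (hb : b₁ ≤ b₂)
    (hb₂ : 0 < b₂) (h : b₁ * a₂ ≤ a₁ * b₂) :
    |a₂| + |b₂| ≤ (slopeConst β ω + 1) / ω * (a₁ + β * a₂ + ω * b₂) +
      ((slopeConst β ω + 1) / ω * slopeConst β ω + 1 / ω) * |b₁ + β * b₂ - ω * a₂| := by
  set l := slopeConst β ω with hl
  have hlω : l * ω = |β| + 1 := div_mul_cancel₀ _ hω.ne'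
  have hl0 : 0 ≤ l := div_nonneg (by positivity) hω.le
  set s := b₁ + β * b₂ with hs
  set i := s - ω * a₂ with hi
  have hsabs : |s| ≤ l * ω * b₂ := by
    rw [hlω]
    calc |s| ≤ |b₁| + |β * b₂| := abs_add_le _ _
      _ = b₁ + |β| * b₂ := by rw [abs_of_nonneg hb₁, abs_mul, abs_of_pos hb₂]
      _ ≤ (|β| + 1) * b₂ := by linarith
  have hsi : s * i ≤ l * ω * b₂ * |i| :=
    (le_abs_self _).trans (by
      rw [abs_mul]
      exact mul_le_mul_of_nonneg_right hsabs (abs_nonneg i))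
  have h₁ : ω * b₂ ≤ a₁ + β * a₂ + ω * b₂ + l * |i| := by
    have h₂ : ω * b₂ * (ω * b₂) ≤ ω * b₂ * (a₁ + β * a₂ + ω * b₂ + l * |i|) := by
      have h₃ : 0 ≤ ω * (s * a₂) + ω * b₂ * (l * |i|) := by
        have h₄ : ω * (s * a₂) = s * s - s * i := by
          rw [hi]
          ring
        rw [h₄]
        linarith [mul_self_nonneg s]
      have h₅ : s * a₂ ≤ (a₁ + β * a₂) * b₂ := by
        rw [hs]
        linarith
      have h₆ := mul_le_mul_of_nonneg_left h₅ hω.le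
      linarith
    exact le_of_mul_le_mul_left h₂ (mul_pos hω hb₂)
  have h₂ : ω * |a₂| ≤ l * ω * b₂ + |i| := by
    calc ω * |a₂| = |s - i| := by
          rw [hi, sub_sub_cancel, abs_mul, abs_of_pos hω]
      _ ≤ |s| + |i| := abs_sub _ _
      _ ≤ l * ω * b₂ + |i| := by linarith
  rw [abs_of_pos hb₂]
  have h₃ : |a₂| ≤ l * b₂ + |i| / ω := by
    rw [← mul_le_mul_iff_of_pos_left hω]
    calc ω * |a₂| ≤ l * ω * b₂ + |i| := h₂
      _ = ω * (l * b₂ + |i| / ω) := by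
        field_simp
  have h₄ : b₂ ≤ (a₁ + β * a₂ + ω * b₂ + l * |i|) / ω := by
    rw [le_div_iff₀ hω, mul_comm]
    exact h₁
  calc |a₂| + b₂ ≤ (l + 1) * b₂ + |i| / ω := by linarith
    _ ≤ (l + 1) * ((a₁ + β * a₂ + ω * b₂ + l * |i|) / ω) + |i| / ω := by gcongr
    _ = _ := by ring

/-- The imaginary part of Z dominates b₁ and b₂, hence also ωa₂ = b₁ + βb₂ - Im Z. This serves both
slopes ≥ 1 and torsion objects. -/
theorem norm_le_of_add_le {β ω a₂ b₁ b₂ : ℝ} (hω : 0 < ω) (hb₁ : 0 ≤ b₁) (hb₂ : 0 ≤ b₂)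
    (h : b₁ + b₂ ≤ b₁ + β * b₂ - ω * a₂) :
    |a₂| + |b₂| ≤ (slopeConst β ω + 1 / ω + 1) * (b₁ + β * b₂ - ω * a₂) := by
  set i := b₁ + β * b₂ - ω * a₂ with hi
  have h₁ : ω * |a₂| ≤ (|β| + 1) * i + i := by
    calc ω * |a₂| = |b₁ + β * b₂ - i| := by
          rw [hi, sub_sub_cancel, abs_mul, abs_of_pos hω]
      _ ≤ |b₁ + β * b₂| + |i| := abs_sub _ _
      _ ≤ |b₁| + |β * b₂| + |i| := by gcongr; exact abs_add_le _ _
      _ = b₁ + |β| * b₂ + i := by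
        rw [abs_of_nonneg hb₁, abs_mul, abs_of_nonneg hb₂, abs_of_nonneg (show 0 ≤ i by linarith)]
      _ ≤ i + |β| * i + i := by gcongr <;> linarith
      _ = _ := by ring
  have h₂ : |a₂| ≤ (slopeConst β ω + 1 / ω) * i := by
    rw [← mul_le_mul_iff_of_pos_left hω]
    calc ω * |a₂| ≤ (|β| + 1) * i + i := h₁
      _ = ω * ((slopeConst β ω + 1 / ω) * i) := by
        rw [slopeConst]
        field_simp
  rw [abs_of_nonneg hb₂]
  linarith

/-! ### Bounds on the pieces of the tilted heart, and their assembly -/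

section Tilt

variable {D D₁ D₂ C : Type*}
  [Category D] [HasZeroObject D] [Preadditive D] [HasShift D ℤ]
  [∀ n : ℤ, (shiftFunctor D n).Additive] [Pretriangulated D]
  [Category D₁] [HasZeroObject D₁] [Preadditive D₁] [HasShift D₁ ℤ]
  [∀ n : ℤ, (shiftFunctor D₁ n).Additive] [Pretriangulated D₁]
  [Category D₂] [HasZeroObject D₂] [Preadditive D₂] [HasShift D₂ ℤ]
  [∀ n : ℤ, (shiftFunctor D₂ n).Additive] [Pretriangulated D₂]
  [Category C]

namespace SOD

variable {S : SOD D D₁ D₂} {σ₁ : StabilityCondition D₁} {σ₂ : StabilityCondition D₂} {β ω : ℝ}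

theorem charge_of (E : D) : S.charge σ₁ σ₂ β ω (K0.of E) =
    S.z₁ σ₁ E + ((β : ℂ) - Complex.I * ω) * S.z₂ σ₂ E := by
  simp [charge, K0.map_of, z₁, z₂]

theorem charge_re (E : D) : (S.charge σ₁ σ₂ β ω (K0.of E)).re =
    (S.z₁ σ₁ E).re + β * (S.z₂ σ₂ E).re + ω * (S.z₂ σ₂ E).im := by
  rw [charge_of]
  simp
  ring

theorem charge_im (E : D) : (S.charge σ₁ σ₂ β ω (K0.of E)).im =
    (S.z₁ σ₁ E).im + β * (S.z₂ σ₂ E).im - ω * (S.z₂ σ₂ E).re := by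
  rw [charge_of]
  simp
  ring

theorem charge_of_distTri {X Y Z : D} (h : DistTri X Y Z) : S.charge σ₁ σ₂ β ω (K0.of Y) =
    S.charge σ₁ σ₂ β ω (K0.of X) + S.charge σ₁ σ₂ β ω (K0.of Z) := by
  rw [h.K0_of, map_add]

theorem charge_of_isZero {X : D} (h : IsZero X) : S.charge σ₁ σ₂ β ω (K0.of X) = 0 := by
  rw [K0.of_isZero h, map_zero]

theorem norm_z₂_le (E : D) : ‖S.z₂ σ₂ E‖ ≤ |(S.z₂ σ₂ E).re| + |(S.z₂ σ₂ E).im| :=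
  Complex.norm_le_abs_re_add_abs_im _

theorem charge_im_of_slopeSemistable {G : D} {s : ℝ} (hG : S.slopeSemistable σ₁ σ₂ β ω s G) :
    (S.charge σ₁ σ₂ β ω (K0.of G)).im = s * ((S.z₁ σ₁ G).im + (S.z₂ σ₂ G).im) := by
  have h := hG.2.2.1
  rw [slope_eq, div_eq_iff (im_pos_of_gluedFree hG.1 hG.2.1).ne'] at h
  rw [charge_im]
  linarith

theorem norm_z₂_le_of_slope_lt_one [IsTriangulated D₁] [IsTriangulated D₂] (c : S.CondTwo C)
    (hω : 0 < ω) (h : S.CondFive σ₁ σ₂ c.toCondOne) {G : D} {s : ℝ}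
    (hG : S.slopeSemistable σ₁ σ₂ β ω s G) (hs : s < 1) :
    ‖S.z₂ σ₂ G‖ ≤ (slopeConst β ω + 1) / ω * (S.charge σ₁ σ₂ β ω (K0.of G)).re +
      ((slopeConst β ω + 1) / ω * slopeConst β ω + 1 / ω) *
        |(S.charge σ₁ σ₂ β ω (K0.of G)).im| := by
  obtain ⟨h₁, h₂⟩ := bogomolov_inequality c hω h hG hs
  have hn := im_nonneg_of_gluedHeart hG.1.1
  have hpos := im_pos_of_gluedFree hG.1 hG.2.1
  rw [charge_re, charge_im]
  exact (norm_z₂_le G).trans (norm_le_of_mul_le_mul hω hn.1 h₁ (by linarith) h₂)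

theorem norm_z₂_le_of_one_le_slope (hω : 0 < ω) {G : D} {s : ℝ}
    (hG : S.slopeSemistable σ₁ σ₂ β ω s G) (hs : 1 ≤ s) :
    ‖S.z₂ σ₂ G‖ ≤ (slopeConst β ω + 1 / ω + 1) * (S.charge σ₁ σ₂ β ω (K0.of G)).im := by
  have hn := im_nonneg_of_gluedHeart hG.1.1
  have h₁ : (S.z₁ σ₁ G).im + (S.z₂ σ₂ G).im ≤ (S.charge σ₁ σ₂ β ω (K0.of G)).im := by
    rw [charge_im_of_slopeSemistable hG]
    exact le_mul_of_one_le_left (add_nonneg hn.1 hn.2) hs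
  rw [charge_im] at h₁ ⊢
  exact (norm_z₂_le G).trans (norm_le_of_add_le hω hn.1 hn.2 h₁)

theorem norm_z₂_le_of_torsion (hω : 0 < ω) {G : D} (hG : S.gluedTorsion σ₁ σ₂ G) :
    0 ≤ (S.charge σ₁ σ₂ β ω (K0.of G)).im ∧
    ((S.charge σ₁ σ₂ β ω (K0.of G)).im = 0 → (S.charge σ₁ σ₂ β ω (K0.of G)).re ≤ 0) ∧
    ‖S.z₂ σ₂ G‖ ≤ (slopeConst β ω + 1 / ω + 1) * (S.charge σ₁ σ₂ β ω (K0.of G)).im := by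
  have h₁ : (S.z₁ σ₁ G).im = 0 := hG.2.1.2
  have h₂ : (S.z₂ σ₂ G).im = 0 := hG.2.2.2
  have h₃ : (S.z₁ σ₁ G).re ≤ 0 := (StabilityCondition.im_nonneg_of_heart hG.1.1).2 h₁
  have h₄ : (S.z₂ σ₂ G).re ≤ 0 := (StabilityCondition.im_nonneg_of_heart hG.1.2).2 h₂
  have h₅ : 0 ≤ (S.charge σ₁ σ₂ β ω (K0.of G)).im := by
    rw [charge_im, h₁, h₂]
    nlinarith
  refine ⟨h₅, ?_, ?_⟩
  · rw [charge_im, charge_re, h₁, h₂]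
    intro h₆
    have h₇ : (S.z₂ σ₂ G).re = 0 := by
      have : ω * (S.z₂ σ₂ G).re = 0 := by linarith
      exact (mul_eq_zero.1 this).resolve_left hω.ne'
    rw [h₇]
    linarith
  · rw [charge_im] at h₅ ⊢
    exact (norm_z₂_le G).trans
      (norm_le_of_add_le hω h₁.ge h₂.ge (by linarith))

variable (S σ₁ σ₂ β ω) in
/-- `E` has a `μ_{β,ω}`-Harder-Narasimhan filtration with slopes in `I`. -/
abbrev HasSlopes (I : Set ℝ) (E : D) : Prop := HasHN (S.slopeSemistable σ₁ σ₂ β ω) I E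

theorem HasSlopes.gluedFree {I : Set ℝ} {E : D} (h : S.HasSlopes σ₁ σ₂ β ω I E) :
    S.gluedFree σ₁ σ₂ E :=
  h.induction _ (fun _ => gluedFree_of_isZero)
    (fun _ _ _ t hX hZ _ => gluedFree_ext t hX (hZ.elim fun _ hs => hs.2.1))

theorem HasSlopes.im_pos {I : Set ℝ} (hI : ∀ s ∈ I, 0 < s) {E : D}
    (h : S.HasSlopes σ₁ σ₂ β ω I E) :
    IsZero E ∨ 0 < (S.charge σ₁ σ₂ β ω (K0.of E)).im := by
  refine h.induction (fun E => IsZero E ∨ 0 < (S.charge σ₁ σ₂ β ω (K0.of E)).im)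
    (fun _ => Or.inl) ?_
  rintro X Y Z t hX ⟨s, hs, hZ⟩ -
  have hZ' : 0 < (S.charge σ₁ σ₂ β ω (K0.of Z)).im := by
    rw [charge_im_of_slopeSemistable hZ]
    exact mul_pos (hI s hs) (im_pos_of_gluedFree hZ.1 hZ.2.1)
  rw [charge_of_distTri t, Complex.add_im]
  rcases hX with hX | hX
  · rw [charge_of_isZero hX]
    exact Or.inr (by simpa using hZ')
  · exact Or.inr (add_pos hX hZ')

theorem HasSlopes.im_nonneg {I : Set ℝ} (hI : ∀ s ∈ I, 0 < s) {E : D}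
    (h : S.HasSlopes σ₁ σ₂ β ω I E) : 0 ≤ (S.charge σ₁ σ₂ β ω (K0.of E)).im :=
  (h.im_pos hI).elim (fun h0 => by simp [charge_of_isZero h0]) le_of_lt

theorem norm_z₂_add_le {X Y Z : D} (t : DistTri X Y Z) :
    ‖S.z₂ σ₂ Y‖ ≤ ‖S.z₂ σ₂ X‖ + ‖S.z₂ σ₂ Z‖ := by
  rw [z₂_of_distTri t]
  exact norm_add_le _ _

/-- The right-hand side is additive on triangles and the norm is subadditive, so the bound passes
from the factors to `E`. In the two analogues below, the slopes have a fixed sign so that |Im Z| is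
additive as well. -/
theorem HasSlopes.norm_z₂_le_of_one_le (hω : 0 < ω) {E : D}
    (h : S.HasSlopes σ₁ σ₂ β ω (Set.Ioi 0 \ Set.Iio 1) E) :
    ‖S.z₂ σ₂ E‖ ≤ (slopeConst β ω + 1 / ω + 1) * (S.charge σ₁ σ₂ β ω (K0.of E)).im := by
  refine h.induction (fun E => ‖S.z₂ σ₂ E‖ ≤ (slopeConst β ω + 1 / ω + 1) *
    (S.charge σ₁ σ₂ β ω (K0.of E)).im)
    (fun X hX => by simp [z₂_of_isZero hX, charge_of_isZero hX]) ?_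
  rintro X Y Z t hX ⟨s, hs, hZ⟩ -
  have hZ' := norm_z₂_le_of_one_le_slope hω hZ (not_lt.1 hs.2)
  rw [charge_of_distTri t, Complex.add_im]
  linarith [norm_z₂_add_le (S := S) (σ₂ := σ₂) t]

theorem HasSlopes.norm_z₂_le_of_lt_one [IsTriangulated D₁] [IsTriangulated D₂]
    (c : S.CondTwo C) (hω : 0 < ω) (hσ : S.CondFive σ₁ σ₂ c.toCondOne) {E : D}
    (h : S.HasSlopes σ₁ σ₂ β ω (Set.Ioi 0 ∩ Set.Iio 1) E) :
    ‖S.z₂ σ₂ E‖ ≤ (slopeConst β ω + 1) / ω * (S.charge σ₁ σ₂ β ω (K0.of E)).re +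
      ((slopeConst β ω + 1) / ω * slopeConst β ω + 1 / ω) *
        (S.charge σ₁ σ₂ β ω (K0.of E)).im := by
  refine h.induction (fun E => ‖S.z₂ σ₂ E‖ ≤ (slopeConst β ω + 1) / ω *
    (S.charge σ₁ σ₂ β ω (K0.of E)).re + ((slopeConst β ω + 1) / ω * slopeConst β ω + 1 / ω) *
      (S.charge σ₁ σ₂ β ω (K0.of E)).im)
    (fun X hX => by simp [z₂_of_isZero hX, charge_of_isZero hX]) ?_
  rintro X Y Z t hX ⟨s, hs, hZ⟩ -
  have hZ' := norm_z₂_le_of_slope_lt_one c hω hσ hZ hs.2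
  rw [abs_of_nonneg] at hZ'
  · rw [charge_of_distTri t, Complex.add_im, Complex.add_re]
    linarith [norm_z₂_add_le (S := S) (σ₂ := σ₂) t]
  · rw [charge_im_of_slopeSemistable hZ]
    exact mul_nonneg (le_of_lt hs.1) (im_pos_of_gluedFree hZ.1 hZ.2.1).le

theorem HasSlopes.norm_z₂_le_of_nonpos [IsTriangulated D₁] [IsTriangulated D₂]
    (c : S.CondTwo C) (hω : 0 < ω) (hσ : S.CondFive σ₁ σ₂ c.toCondOne) {E : D}
    (h : S.HasSlopes σ₁ σ₂ β ω (Set.Iic 0) E) :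
    (S.charge σ₁ σ₂ β ω (K0.of E)).im ≤ 0 ∧
    ‖S.z₂ σ₂ E‖ ≤ (slopeConst β ω + 1) / ω * (S.charge σ₁ σ₂ β ω (K0.of E)).re -
      ((slopeConst β ω + 1) / ω * slopeConst β ω + 1 / ω) *
        (S.charge σ₁ σ₂ β ω (K0.of E)).im := by
  refine h.induction (fun E => (S.charge σ₁ σ₂ β ω (K0.of E)).im ≤ 0 ∧
    ‖S.z₂ σ₂ E‖ ≤ (slopeConst β ω + 1) / ω * (S.charge σ₁ σ₂ β ω (K0.of E)).re -
      ((slopeConst β ω + 1) / ω * slopeConst β ω + 1 / ω) *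
        (S.charge σ₁ σ₂ β ω (K0.of E)).im)
    (fun X hX => by simp [z₂_of_isZero hX, charge_of_isZero hX]) ?_
  rintro X Y Z t hX ⟨s, hs, hZ⟩ -
  have hs' : s ≤ 0 := hs
  have hZ' := norm_z₂_le_of_slope_lt_one c hω hσ hZ (by linarith)
  have hZ'' : (S.charge σ₁ σ₂ β ω (K0.of Z)).im ≤ 0 := by
    rw [charge_im_of_slopeSemistable hZ]
    exact mul_nonpos_of_nonpos_of_nonneg hs' (im_pos_of_gluedFree hZ.1 hZ.2.1).le
  rw [abs_of_nonpos hZ''] at hZ'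
  rw [charge_of_distTri t, Complex.add_im, Complex.add_re]
  exact ⟨add_nonpos hX.1 hZ'', by linarith [hX.2, norm_z₂_add_le (S := S) (σ₂ := σ₂) t]⟩

theorem tiltF_of_isZero {X : D} (hX : IsZero X) : S.tiltF σ₁ σ₂ β ω X :=
  ⟨gluedFree_of_isZero hX, HasHN.of_isZero (I := Set.Iic 0) hX⟩

theorem gluedTorsion_of_isZero {X : D} (hX : IsZero X) : S.gluedTorsion σ₁ σ₂ X := by
  have h := gluedHeart_of_isZero (S := S) (σ₁ := σ₁) (σ₂ := σ₂) hX
  refine ⟨h, ⟨h.1, ?_⟩, ⟨h.2, ?_⟩⟩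
  · rw [σ₁.Z_of_isZero (S.τ₁L.map_isZero hX), Complex.zero_im]
  · rw [σ₂.Z_of_isZero (S.τ₂R.map_isZero hX), Complex.zero_im]

theorem tiltT_of_distTri {T E Q : D} (t : DistTri T E Q) (hT : S.gluedTorsion σ₁ σ₂ T)
    (hQ : S.HasSlopes σ₁ σ₂ β ω (Set.Ioi 0) Q) : S.tiltT σ₁ σ₂ β ω E := by
  obtain ⟨f, g, h, ht⟩ := t
  exact ⟨gluedHeart_ext ⟨f, g, h, ht⟩ hT.1 hQ.gluedFree.1, T, Q, f, g, h, hT, hQ.gluedFree, ht, hQ⟩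

theorem tiltT_of_hasSlopes {Q : D} (hQ : S.HasSlopes σ₁ σ₂ β ω (Set.Ioi 0) Q) :
    S.tiltT σ₁ σ₂ β ω Q :=
  tiltT_of_distTri (DistTri.of_iso_right (isZero_zero D) (Iso.refl Q))
    (gluedTorsion_of_isZero (isZero_zero D)) hQ

theorem tiltedHeart_of_distTri {F E T : D} (t : DistTri (F⟦(1 : ℤ)⟧) E T)
    (hF : S.tiltF σ₁ σ₂ β ω F) (hT : S.tiltT σ₁ σ₂ β ω T) : S.tiltedHeart σ₁ σ₂ β ω E := by
  obtain ⟨f, g, h, ht⟩ := t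
  exact ⟨F, T, f, g, h, hF, hT, ht⟩

theorem tiltedHeart_of_tiltF {F : D} (hF : S.tiltF σ₁ σ₂ β ω F) :
    S.tiltedHeart σ₁ σ₂ β ω (F⟦(1 : ℤ)⟧) :=
  tiltedHeart_of_distTri (DistTri.of_iso_left (Iso.refl _) (isZero_zero D)) hF
    (tiltT_of_hasSlopes (HasHN.of_isZero (isZero_zero D)))

theorem tiltedHeart_of_tiltT {T : D} (hT : S.tiltT σ₁ σ₂ β ω T) :
    S.tiltedHeart σ₁ σ₂ β ω T :=
  tiltedHeart_of_distTri (DistTri.of_iso_right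
    ((shiftFunctor D (1 : ℤ)).map_isZero (isZero_zero D)) (Iso.refl _))
    (tiltF_of_isZero (isZero_zero D)) hT

theorem re_mul_im_le_of_semistable {X Y Z : D}
    (hX : IsHeartSemistable (S.tiltedHeart σ₁ σ₂ β ω) (S.charge σ₁ σ₂ β ω) X)
    (t : DistTri Y X Z) (hY : S.tiltedHeart σ₁ σ₂ β ω Y) (hZ : S.tiltedHeart σ₁ σ₂ β ω Z)
    (him : 0 ≤ (S.charge σ₁ σ₂ β ω (K0.of Y)).im) :
    (S.charge σ₁ σ₂ β ω (K0.of X)).re * (S.charge σ₁ σ₂ β ω (K0.of Y)).im ≤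
      (S.charge σ₁ σ₂ β ω (K0.of Y)).re * (S.charge σ₁ σ₂ β ω (K0.of X)).im := by
  by_cases h0 : IsZero Y
  · simp [charge_of_isZero h0]
  · obtain ⟨f, g, h, ht⟩ := t
    exact re_mul_im_le_of_arg_le him (hX.2.2 Y h0 ⟨hY, Z, f, g, h, hZ, ht⟩)

/-- A constant `M` with `|Z₂(τ₂R E)| ≤ M |Z_{β,ω}(E)|` for all semistable `E`. -/
def supportConst (β ω : ℝ) : ℝ :=
  3 * ((slopeConst β ω + 1) / ω) + 2 * ((slopeConst β ω + 1) / ω * slopeConst β ω + 1 / ω) +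
    (slopeConst β ω + 1 / ω + 1)

/-- Here `f`, `u`, `q` are the charges of the three pieces and N is the norm of their sum. All
imaginary parts lie in [0, N], so only -Re f and Re q need control. Testing the subobject of charge
`f` gives Re f ≥ -N; testing the one of charge `f + u` gives Re (f + u) ≥ -N, so Re q ≤ 2N. -/
theorem norm_le_of_sum {f u q : ℂ} {n₁ n₂ n₃ A B B' : ℝ} (hA : 0 ≤ A) (hB : 0 ≤ B)
    (hB' : 0 ≤ B') (hf : 0 ≤ f.im) (hu : 0 ≤ u.im) (hq : 0 ≤ q.im) (hq' : q.im = 0 → q = 0)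
    (hu' : u.im = 0 → u.re ≤ 0) (h₁ : n₁ ≤ A * (-f.re) + B * f.im) (h₂ : n₂ ≤ B' * u.im)
    (h₃ : n₃ ≤ A * q.re + B * q.im)
    (hfs : (f + u + q).re * f.im ≤ f.re * (f + u + q).im)
    (hus : (f + u + q).re * (f + u).im ≤ (f + u).re * (f + u + q).im) :
    n₁ + n₂ + n₃ ≤ (3 * A + 2 * B + B') * ‖f + u + q‖ := by
  have hre := Complex.abs_re_le_norm (f + u + q)
  have him := (le_abs_self _).trans (Complex.abs_im_le_norm (f + u + q))
  set N := ‖f + u + q‖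
  have hx := abs_le.1 hre
  simp only [Complex.add_re, Complex.add_im] at *
  have key : -f.re ≤ N ∧ q.re ≤ 2 * N := by
    -- When the total imaginary part is 0, the semistability inequalities are vacuous; instead q = 0
    -- and Re u ≤ 0 give the bounds.
    rcases (add_nonneg (add_nonneg hf hu) hq).eq_or_lt with hy | hy
    · have hq0 := hq' (by linarith)
      have hu0 := hu' (by linarith)
      simp only [hq0, Complex.zero_re] at *
      constructor <;> linarith
    · have hN : 0 ≤ N := norm_nonneg _
      constructor
      · have h₄ : -N * (f.im + u.im + q.im) ≤ f.re * (f.im + u.im + q.im) := by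
          refine le_trans ?_ hfs
          nlinarith
        linarith [le_of_mul_le_mul_right h₄ hy]
      · have h₄ : -N * (f.im + u.im + q.im) ≤ (f.re + u.re) * (f.im + u.im + q.im) := by
          refine le_trans ?_ hus
          nlinarith
        linarith [le_of_mul_le_mul_right h₄ hy]
  have h₄ : A * (-f.re) ≤ A * N := mul_le_mul_of_nonneg_left key.1 hA
  have h₅ : A * q.re ≤ A * (2 * N) := mul_le_mul_of_nonneg_left key.2 hA
  have h₆ : B * f.im ≤ B * N := mul_le_mul_of_nonneg_left (by linarith) hB
  have h₇ : B * q.im ≤ B * N := mul_le_mul_of_nonneg_left (by linarith) hB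
  have h₈ : B' * u.im ≤ B' * N := mul_le_mul_of_nonneg_left (by linarith) hB'
  linarith

/-- Compare a semistable object of the tilted heart, an extension of `T` by `F⟦1⟧`, with the
subobject `F⟦1⟧` and with the kernel of its map to the quotient of `T` of slopes in `(0, 1)`. -/
theorem norm_z₂_le_of_isHeartSemistable [IsTriangulated D] [IsTriangulated D₁]
    [IsTriangulated D₂] (c : S.CondTwo C) (hω : 0 < ω) (hσ : S.CondFive σ₁ σ₂ c.toCondOne)
    {X : D} (hX : IsHeartSemistable (S.tiltedHeart σ₁ σ₂ β ω) (S.charge σ₁ σ₂ β ω) X) :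
    ‖S.z₂ σ₂ X‖ ≤ supportConst β ω * ‖S.charge σ₁ σ₂ β ω (K0.of X)‖ := by
  obtain ⟨F, T, f, g, h, hF, ⟨-, T₀, Q, f', g', h', hT₀, -, hT', hQ⟩, hT⟩ := hX.1
  have tX : DistTri (F⟦(1 : ℤ)⟧) X T := ⟨f, g, h, hT⟩
  have tT : DistTri T₀ T Q := ⟨f', g', h', hT'⟩
  have hQ' : S.HasSlopes σ₁ σ₂ β ω (Set.Ioi 0) Q := hQ
  -- Slope 1 is where the quadratic inequality stops being available. `U` is the fibre of `T ⟶ Q₂`,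
  -- an extension of `Q₁` by the torsion part; `W` is the fibre of `X ⟶ Q₂`, an extension of `U` by
  -- `F⟦1⟧`, and is the second test subobject.
  obtain ⟨Q₁, Q₂, tQ, hQ₁, hQ₂⟩ := hQ'.split (isLowerSet_Iio 1)
  obtain ⟨U, tU, tU'⟩ := tT.exists_fiber tQ
  obtain ⟨W, tW, tW'⟩ := tX.exists_fiber tU
  have hT : S.tiltT σ₁ σ₂ β ω T := tiltT_of_distTri tT hT₀ hQ'
  have hU : S.tiltT σ₁ σ₂ β ω U := tiltT_of_distTri tU' hT₀ (hQ₁.mono Set.sdiff_subset)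
  have hQ₂' : S.tiltT σ₁ σ₂ β ω Q₂ := tiltT_of_hasSlopes (hQ₂.mono Set.inter_subset_left)
  have hF' := HasSlopes.norm_z₂_le_of_nonpos c hω hσ hF.2
  have hU₀ := norm_z₂_le_of_torsion (β := β) hω hT₀
  have hU₁ := HasSlopes.norm_z₂_le_of_one_le hω hQ₁
  have hU₁' := HasSlopes.im_pos (fun s hs => hs.1) hQ₁
  have hU₁'' := HasSlopes.im_nonneg (fun s hs => hs.1) hQ₁
  have hq := HasSlopes.norm_z₂_le_of_lt_one c hω hσ hQ₂
  have hq' := HasSlopes.im_pos (fun s hs => hs.1) hQ₂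
  have hq'' := HasSlopes.im_nonneg (fun s hs => hs.1) hQ₂
  have hFshift : S.charge σ₁ σ₂ β ω (K0.of (F⟦(1 : ℤ)⟧)) = -S.charge σ₁ σ₂ β ω (K0.of F) := by
    rw [K0.of_shift_one, map_neg]
  have hzF : ‖S.z₂ σ₂ (F⟦(1 : ℤ)⟧)‖ = ‖S.z₂ σ₂ F‖ := by
    have h₁ := norm_map_K0_shift (σ₂.Z.comp (K0.map S.τ₂R)) F 1
    simp only [AddMonoidHom.comp_apply, K0.map_of] at h₁
    exact h₁
  have hUsum := charge_of_distTri (S := S) (σ₁ := σ₁) (σ₂ := σ₂) (β := β) (ω := ω) tU'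
  have hWsum := charge_of_distTri (S := S) (σ₁ := σ₁) (σ₂ := σ₂) (β := β) (ω := ω) tW'
  have hXsum := charge_of_distTri (S := S) (σ₁ := σ₁) (σ₂ := σ₂) (β := β) (ω := ω) tW
  have hUim : 0 ≤ (S.charge σ₁ σ₂ β ω (K0.of U)).im := by
    rw [hUsum, Complex.add_im]
    exact add_nonneg hU₀.1 hU₁''
  have hfim : 0 ≤ (S.charge σ₁ σ₂ β ω (K0.of (F⟦(1 : ℤ)⟧))).im := by
    rw [hFshift, Complex.neg_im]
    exact neg_nonneg.2 hF'.1
  have s₁ := re_mul_im_le_of_semistable hX tX (tiltedHeart_of_tiltF hF) (tiltedHeart_of_tiltT hT)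
    hfim
  have s₂ := re_mul_im_le_of_semistable hX tW (tiltedHeart_of_distTri tW' hF hU)
    (tiltedHeart_of_tiltT hQ₂') (by
      rw [hWsum, Complex.add_im]
      exact add_nonneg hfim hUim)
  have hl : 0 ≤ slopeConst β ω := div_nonneg (by positivity) hω.le
  rw [hWsum] at hXsum s₂
  rw [hXsum] at s₁ s₂ ⊢
  have hsum : ‖S.z₂ σ₂ X‖ ≤ ‖S.z₂ σ₂ F‖ + ‖S.z₂ σ₂ U‖ + ‖S.z₂ σ₂ Q₂‖ := by
    rw [← hzF]
    linarith [norm_z₂_add_le (S := S) (σ₂ := σ₂) tW, norm_z₂_add_le (S := S) (σ₂ := σ₂) tW']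
  refine hsum.trans (norm_le_of_sum (by positivity) (by positivity) (by positivity) hfim hUim
    hq'' ?_ ?_ ?_ ?_ hq s₁ s₂)
  · intro h0
    rcases hq' with h₁ | h₁
    · exact charge_of_isZero h₁
    · exact absurd h0 h₁.ne'
  · rw [hUsum, Complex.add_im, Complex.add_re]
    intro h0
    rcases hU₁' with h₁ | h₁
    · rw [charge_of_isZero h₁, Complex.zero_re, add_zero]
      exact hU₀.2.1 (by linarith [hU₀.1])
    · linarith [hU₀.1]
  · rw [hFshift, Complex.neg_re, Complex.neg_im, neg_neg]
    linarith [hF'.2]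
  · rw [hUsum, Complex.add_im]
    linarith [norm_z₂_add_le (S := S) (σ₂ := σ₂) tU', hU₀.2.2]

theorem norm_z₂_le_of_isSemistable [IsTriangulated D] [IsTriangulated D₁]
    [IsTriangulated D₂] (c : S.CondTwo C) (hω : 0 < ω) (hσ : S.CondFive σ₁ σ₂ c.toCondOne)
    {E : D} (hE : S.IsSemistable σ₁ σ₂ β ω E) :
    ‖S.z₂ σ₂ E‖ ≤ supportConst β ω * ‖S.charge σ₁ σ₂ β ω (K0.of E)‖ := by
  obtain ⟨n, hn⟩ := hE
  have h₁ := norm_z₂_le_of_isHeartSemistable c hω hσ hn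
  have h₂ := norm_map_K0_shift (σ₂.Z.comp (K0.map S.τ₂R)) E n
  simp only [AddMonoidHom.comp_apply, K0.map_of] at h₂
  rw [norm_map_K0_shift] at h₁
  rw [z₂, ← h₂]
  exact h₁

theorem norm_charge_i₂_τ₂R (E : D) :
    ‖S.charge σ₁ σ₂ β ω (K0.of (S.i₂.obj (S.τ₂R.obj E)))‖ =
      ‖(β : ℂ) - Complex.I * ω‖ * ‖S.z₂ σ₂ E‖ := by
  have h₁ : S.z₁ σ₁ (S.i₂.obj (S.τ₂R.obj E)) = 0 := σ₁.Z_of_isZero (S.τ₁L_i₂ _)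
  have h₂ : S.z₂ σ₂ (S.i₂.obj (S.τ₂R.obj E)) = S.z₂ σ₂ E := by
    rw [z₂, z₂, K0.of_iso (S.τ₂RI₂ (S.τ₂R.obj E))]
  rw [charge_of, h₁, h₂, zero_add, norm_mul]

end SOD

/-- If b = 0, the hypothesis forces a = 0, and 0 / 0 = 0 in `ℝ≥0∞`. -/
theorem enorm_div_enorm_le {a b : ℂ} {M : ℝ} (h : ‖a‖ ≤ M * ‖b‖) :
    ‖a‖ₑ / ‖b‖ₑ ≤ ENNReal.ofReal M := by
  refine ENNReal.div_le_of_le_mul ?_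
  rw [← ofReal_norm, ← ofReal_norm b, ← ENNReal.ofReal_mul' (norm_nonneg b)]
  exact ENNReal.ofReal_le_ofReal h

end Tilt

end GluingStability

end

theorem mainTheorem4
    {D D₁ D₂ C : Type*}
    [Category D] [HasZeroObject D] [Preadditive D] [HasShift D ℤ]
    [∀ n : ℤ, (shiftFunctor D n).Additive] [Pretriangulated D] [IsTriangulated D]
    [Category D₁] [HasZeroObject D₁] [Preadditive D₁] [HasShift D₁ ℤ]
    [∀ n : ℤ, (shiftFunctor D₁ n).Additive] [Pretriangulated D₁] [IsTriangulated D₁]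
    [Category D₂] [HasZeroObject D₂] [Preadditive D₂] [HasShift D₂ ℤ]
    [∀ n : ℤ, (shiftFunctor D₂ n).Additive] [Pretriangulated D₂] [IsTriangulated D₂]
    [Category C]
    (hK : AddGroup.FG (GluingStability.K0 D))
    (S : GluingStability.SOD D D₁ D₂) (c : S.CondTwo C)
    (σ₁ : GluingStability.StabilityCondition D₁) (σ₂ : GluingStability.StabilityCondition D₂)
    (hσ₁ : σ₁.IsRational) (hσ₂ : σ₂.IsRational)
    (hσ : S.CondFive σ₁ σ₂ c.toCondOne)
    (ε₁ ε₂ : ℝ) (hε₁ : ε₁ ∈ Set.Ioo (0 : ℝ) (1 / 2)) (hε₂ : ε₂ < 0)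
    (β ω : ℝ)
    (hβω : (β, ω) ∈ GluingStability.rationalPoints
      (GluingStability.Hplus ε₁ ∩ GluingStability.Hminus ε₂)) :
    (⨆ (E : D) (_ : S.IsSemistable σ₁ σ₂ β ω E),
        ‖S.charge σ₁ σ₂ β ω (GluingStability.K0.of (S.i₂.obj (S.τ₂R.obj E)))‖ₑ
          / ‖S.charge σ₁ σ₂ β ω (GluingStability.K0.of E)‖ₑ) < ⊤ ∧
    (⨆ (E : D) (_ : S.IsSemistable σ₁ σ₂ β ω E),
        ‖σ₂.Z (GluingStability.K0.of (S.τ₂R.obj E))‖ₑ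
          / ‖S.charge σ₁ σ₂ β ω (GluingStability.K0.of E)‖ₑ) < ⊤ := by
  have hω : 0 < ω := hβω.1.1.1
  have key := fun (E : D) (hE : S.IsSemistable σ₁ σ₂ β ω E) =>
    GluingStability.SOD.norm_z₂_le_of_isSemistable c hω hσ hE
  constructor
  · refine lt_of_le_of_lt (iSup₂_le fun E hE =>
      GluingStability.enorm_div_enorm_le (M := ‖(β : ℂ) - Complex.I * ω‖ *
        GluingStability.SOD.supportConst β ω) ?_) ENNReal.ofReal_lt_top
    rw [GluingStability.SOD.norm_charge_i₂_τ₂R, mul_assoc]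
    exact mul_le_mul_of_nonneg_left (key E hE) (norm_nonneg _)
  · exact lt_of_le_of_lt (iSup₂_le fun E hE =>
      GluingStability.enorm_div_enorm_le (key E hE)) ENNReal.ofReal_lt_top
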